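/- **Setting.** For a path $g$ in $\mathbb R^2$ starting at $(0,0)$, close $g$ by the segment from its endpoint back to $(0,0)$ and let $w_g$ be the winding number function of the closed curve. Put $\hat g\in\mathbb R^2$ for the endpoint of $g$, $A(g)=\iint w_g\,dx\,dy\in\mathbb R$ (signed area) and $B(g)=\iint (x,y)\,w_g\,dx\,dy\in\mathbb R^2$ (non-normalized barycenter). Paths with the same $(\hat g,A(g),B(g))$ are identified; concatenation then gives a group $\mathcal C_{\mathbb R}$, with $$\widehat{gh}=\hat g+\hat h,\qquad A(gh)=A(g)+A(h)+\tfrac12\det(\hat g,\hat h),$$ $$B(gh)=B(g)+B(h)+A(h)\,\hat g+\tfrac13(2\hat g+\hat h)\cdot\tfrac12\det(\hat g,\hat h).$$ The Cartan group is $\mathcal C=\langle x,y\rangle\le\mathcal C_{\mathbb R}$, where $x,y$ are the segments from $(0,0)$ to $(1,0)$ and to $(0,1)$. Let $S=\{x^{\pm1},y^{\pm1}\}$, let $\|\cdot\|_S$ be the word length and $d(g,h)=\|g^{-1}h\|_S$. Let $u\in\mathbb S^1$, and let $u^\perp$ be its image under the rotation by $+90^\circ$. Let $\hat\gamma_u=(\hat\gamma_{u,n})_{n\ge0}$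 be the path in $\mathbb Z^2$ from $(0,0)$, moving by unit steps in the closed quadrant of $u$, that separates the unit squares of the grid whose center is on one side of the ray $\mathbb R^+u$ from those whose center is on the other side; the squares whose center lies on the ray are left alternately on one side and on the other (with either choice for the first one). Let $\gamma_u=(\gamma_{u,n})_{n\ge0}$ be its lift to $\mathcal C$ with $\gamma_{u,0}=e$. Write $[a:b]$ for the direction of a nonzero vector $(a,b)$ (up to positive multiples). **Theorem.** For every $g\in\mathcal C$ the limit $b_{\gamma_u}(g)=\lim_{n\to\infty}\big(d(\gamma_{u,n},g)-d(\gamma_{u,n},e)\big)$ exists, and there are constants $C_1,C_2>0$ (which may depend on $u$) such that for all $h\in[\mathcal C,\mathcal C]$: 1. if $\langle -B(h);u^\perp\rangle\ge0$, then $$C_1\sqrt[3]{\langle -B(h);u^\perp\rangle}\le b_{\gamma_u}(h)\le C_2\sqrt[3]{\langle -B(h);u^\perp\rangle+|A(h)|}+C_2;$$ if $\langle -B(h);u^\perp\rangle\le0$, then $$0\le b_{\gamma_u}(h)\le C_2\sqrt[3]{|A(h)|}+C_2.$$ 2. If moreover $u$ is not of the form $[a:b]$ with $a,b$ integers exactly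 one of which is even, then $$C_1\sqrt[3]{\langle -B(h);u^\perp\rangle}\le b_{\gamma_u}(h)\le C_2\sqrt[3]{\langle -B(h);u^\perp\rangle}+C_2\quad\text{if }\langle -B(h);u^\perp\rangle>0,$$ $$|b_{\gamma_u}(h)|\le C_2\quad\text{if }\langle -B(h);u^\perp\rangle\le0.$$ 3. If $u=[a:b]$ with $a,b$ odd integers, then even $$b_{\gamma_u}(h)\le C_2\sqrt[3]{\langle -B(h);u^\perp\rangle}\quad\text{if }\langle -B(h);u^\perp\rangle>0.$$ -/

import Mathlib

open Filter Topology

/-- The real Cartan group `C_ℝ`.  A point is the triple (second endpoint `(x, y)`, signed area `area`,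
non-normalized barycenter `(baryX, baryY)`) attached to a class of planar paths starting from `(0,0)`. -/
@[ext]
structure CartanReal where
  x : ℝ
  y : ℝ
  area : ℝ
  baryX : ℝ
  baryY : ℝ

namespace CartanReal

/-- The second endpoint of a path. -/
def hat (g : CartanReal) : ℝ × ℝ := (g.x, g.y)

/-- The barycenter of a path. -/
def bary (g : CartanReal) : ℝ × ℝ := (g.baryX, g.baryY)

/-- `det (ĝ, ĥ)`. -/
def det (g h : CartanReal) : ℝ := g.x * h.y - g.y * h.x

/-- Concatenation of paths:
`ĝh = ĝ + ĥ`, `A(gh) = A(g) + A(h) + ½ det(ĝ,ĥ)`,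
`B(gh) = B(g) + B(h) + A(h) ĝ + ⅓ (2ĝ + ĥ) · ½ det(ĝ,ĥ)`. -/
noncomputable instance : Mul CartanReal where
  mul g h :=
    { x := g.x + h.x
      y := g.y + h.y
      area := g.area + h.area + 1 / 2 * det g h
      baryX := g.baryX + h.baryX + g.x * h.area + 1 / 3 * (2 * g.x + h.x) * (1 / 2 * det g h)
      baryY := g.baryY + h.baryY + g.y * h.area + 1 / 3 * (2 * g.y + h.y) * (1 / 2 * det g h) }

/-- The empty path. -/
instance : One CartanReal where
  one := { x := 0, y := 0, area := 0, baryX := 0, baryY := 0 }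

/-- The reverse path. -/
noncomputable instance : Inv CartanReal where
  inv g :=
    { x := -g.x
      y := -g.y
      area := -g.area
      baryX := -g.baryX + g.x * g.area
      baryY := -g.baryY + g.y * g.area }

@[simp] theorem mul_x (g h : CartanReal) : (g * h).x = g.x + h.x := rfl
@[simp] theorem mul_y (g h : CartanReal) : (g * h).y = g.y + h.y := rfl
theorem mul_area (g h : CartanReal) :
    (g * h).area = g.area + h.area + 1 / 2 * det g h := rfl
theorem mul_baryX (g h : CartanReal) :
    (g * h).baryX = g.baryX + h.baryX + g.x * h.area + 1 / 3 * (2 * g.x + h.x) * (1 / 2 * det g h) := rfl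
theorem mul_baryY (g h : CartanReal) :
    (g * h).baryY = g.baryY + h.baryY + g.y * h.area + 1 / 3 * (2 * g.y + h.y) * (1 / 2 * det g h) := rfl
@[simp] theorem one_x : (1 : CartanReal).x = 0 := rfl
@[simp] theorem one_y : (1 : CartanReal).y = 0 := rfl
@[simp] theorem one_area : (1 : CartanReal).area = 0 := rfl
@[simp] theorem one_baryX : (1 : CartanReal).baryX = 0 := rfl
@[simp] theorem one_baryY : (1 : CartanReal).baryY = 0 := rfl
@[simp] theorem inv_x (g : CartanReal) : (g⁻¹).x = -g.x := rfl
@[simp] theorem inv_y (g : CartanReal) : (g⁻¹).y = -g.y := rfl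
@[simp] theorem inv_area (g : CartanReal) : (g⁻¹).area = -g.area := rfl
@[simp] theorem inv_baryX (g : CartanReal) : (g⁻¹).baryX = -g.baryX + g.x * g.area := rfl
@[simp] theorem inv_baryY (g : CartanReal) : (g⁻¹).baryY = -g.baryY + g.y * g.area := rfl

noncomputable instance : Group CartanReal :=
  Group.ofLeftAxioms
    (by
      intro a b c
      ext <;> simp only [mul_x, mul_y, mul_area, mul_baryX, mul_baryY, det] <;> ring)
    (by
      intro a
      ext <;> simp only [mul_x, mul_y, mul_area, mul_baryX, mul_baryY, det, one_x, one_y, one_area,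
        one_baryX, one_baryY] <;> ring)
    (by
      intro a
      ext <;> simp only [mul_x, mul_y, mul_area, mul_baryX, mul_baryY, det, one_x, one_y, one_area,
        one_baryX, one_baryY, inv_x, inv_y, inv_area, inv_baryX, inv_baryY] <;> ring)

/-- The segment from `(0,0)` to `(1,0)`. -/
def genX : CartanReal := { x := 1, y := 0, area := 0, baryX := 0, baryY := 0 }

/-- The segment from `(0,0)` to `(0,1)`. -/
def genY : CartanReal := { x := 0, y := 1, area := 0, baryX := 0, baryY := 0 }

end CartanReal

/-- The Cartan group `C = ⟨x, y⟩`, a lattice in `C_ℝ`. -/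
abbrev Cartan : Type := ↥(Subgroup.closure ({CartanReal.genX, CartanReal.genY} : Set CartanReal))

namespace Cartan

/-- The generator `x` of `C`. -/
def X : Cartan := ⟨CartanReal.genX, Subgroup.subset_closure (by simp)⟩

/-- The generator `y` of `C`. -/
def Y : Cartan := ⟨CartanReal.genY, Subgroup.subset_closure (by simp)⟩

/-- The signed area `A(g)`. -/
def A (g : Cartan) : ℝ := g.1.area

/-- The barycenter `B(g)`. -/
def B (g : Cartan) : ℝ × ℝ := g.1.bary

/-- The standard symmetric generating set `S = {x, x⁻¹, y, y⁻¹}`. -/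
def S : Set Cartan := {X, X⁻¹, Y, Y⁻¹}

/-- The word length `‖g‖_S`. -/
noncomputable def norm (g : Cartan) : ℕ :=
  sInf {n : ℕ | ∃ l : List Cartan, l.length = n ∧ (∀ s ∈ l, s ∈ S) ∧ l.prod = g}

/-- The word metric `d_S(g, h) = ‖g⁻¹h‖_S`. -/
noncomputable def dist (g h : Cartan) : ℕ := norm (g⁻¹ * h)

/-- The Busemann function `b_γ(h) = lim_n d(γ_n, h) - d(γ_n, e)`. -/
noncomputable def busemann (γ : ℕ → Cartan) (h : Cartan) : ℝ :=
  limUnder atTop (fun n : ℕ => (dist (γ n) h : ℝ) - (dist (γ n) 1 : ℝ))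

/-! ### The path approximating a ray -/

/-- The Euclidean inner product on `ℝ²`. -/
def dot (v w : ℝ × ℝ) : ℝ := v.1 * w.1 + v.2 * w.2

/-- The image `u^⊥` of `u` under the rotation of `+90°`. -/
def perp (u : ℝ × ℝ) : ℝ × ℝ := (-u.2, u.1)

/-- The direction `±1` in which a coordinate of the path is allowed to move. -/
noncomputable def orient (t : ℝ) : ℤ := if 0 ≤ t then 1 else -1

/-- The center of the unit square lying ahead of the lattice point `p`, in the closed quadrant of
direction `u`. -/
noncomputable def nextCenter (u : ℝ × ℝ) (p : ℤ × ℤ) : ℝ × ℝ :=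
  ((p.1 : ℝ) + orient u.1 / 2, (p.2 : ℝ) + orient u.2 / 2)

/-- Position of the center of the square ahead of `p` relative to the ray `ℝ⁺u`: it is positive
if the center is on the side of the ray containing the vertical side of the quadrant of `u`, negative
if it is on the side containing the horizontal side, zero if it is on the ray. -/
noncomputable def side (u : ℝ × ℝ) (p : ℤ × ℤ) : ℝ :=
  orient u.1 * orient u.2 * dot (nextCenter u p) (perp u)

/-- The path `γ̂_u` in `ℤ²`, separating the unit squares whose centers lie on the two sides of the ray
`ℝ⁺u`. Each step follows the horizontal or the vertical side of the square ahead, so as to leave that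
square on the same side of the path as its center is of the ray.
Squares whose center is on the ray are left alternately on one side and on the other; the Boolean
records whether the next such square is to be passed horizontally first (`true`) or vertically first
(`false`), and `τ` is the choice for the first one. -/
noncomputable def rayState (u : ℝ × ℝ) (τ : Bool) : ℕ → (ℤ × ℤ) × Bool
  | 0 => ((0, 0), τ)
  | n + 1 =>
    let p := (rayState u τ n).1
    let t := (rayState u τ n).2
    let horizontal : ℤ × ℤ := (p.1 + orient u.1, p.2)
    let vertical : ℤ × ℤ := (p.1, p.2 + orient u.2)
    if 0 < side u p then (horizontal, t)
    else if side u p < 0 then (vertical, t)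
    else (if t then horizontal else vertical, !t)

/-- The path `γ̂_u` in `ℤ²`. -/
noncomputable def rayHat (u : ℝ × ℝ) (τ : Bool) (n : ℕ) : ℤ × ℤ := (rayState u τ n).1

/-- The path `γ_u`: the lift of `γ̂_u` to the Cayley graph of `C` starting from the identity. (The step
`γ̂_u(n+1) - γ̂_u(n)` is one of `(±1, 0)`, `(0, ±1)`, so that the last factor is one of
`x^{±1}`, `y^{±1}`.) -/
noncomputable def rayPath (u : ℝ × ℝ) (τ : Bool) : ℕ → Cartan
  | 0 => 1
  | n + 1 => rayPath u τ n *
      (X ^ ((rayHat u τ (n + 1)).1 - (rayHat u τ n).1) *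
        Y ^ ((rayHat u τ (n + 1)).2 - (rayHat u τ n).2))

/-- `u` is of the form `[a : b]`: it is a positive multiple of `(a, b)`. -/
def HasDirection (u : ℝ × ℝ) (a b : ℤ) : Prop :=
  ∃ t : ℝ, 0 < t ∧ u = (t * a, t * b)

end Cartan

/-! ### Consistency check: area and barycenter are integrals of winding numbers

A closed lattice path has constant winding number on every open unit square, so integrals of winding
numbers become finite sums over unit squares.  The square `(i, j)` is `(i, i+1) × (j, j+1)`. -/

namespace Cartan

/-- Unit steps of a lattice path. -/
inductive Step
  | east
  | west
  | north
  | south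

/-- The group element of a step. -/
noncomputable def Step.val : Step → CartanReal
  | east => CartanReal.genX
  | west => CartanReal.genX⁻¹
  | north => CartanReal.genY
  | south => CartanReal.genY⁻¹

/-- The point reached from `p` after a step. -/
def Step.move (p : ℤ × ℤ) : Step → ℤ × ℤ
  | east => (p.1 + 1, p.2)
  | west => (p.1 - 1, p.2)
  | north => (p.1, p.2 + 1)
  | south => (p.1, p.2 - 1)

/-- Signed crossing of a step from `p` with the half-line going from the center of the square `c`
to the right. -/
def Step.cross (p c : ℤ × ℤ) : Step → ℤ
  | east => 0
  | west => 0
  | north => if p.2 = c.2 ∧ c.1 < p.1 then 1 else 0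
  | south => if p.2 - 1 = c.2 ∧ c.1 < p.1 then -1 else 0

/-- The endpoint of a lattice path starting from `p`. -/
def endpoint : ℤ × ℤ → List Step → ℤ × ℤ
  | p, [] => p
  | p, s :: l => endpoint (s.move p) l

/-- The winding number, around the square `c`, of a lattice path starting from `p`
(counted by signed crossings; meaningful for closed paths). -/
def winding : ℤ × ℤ → List Step → ℤ × ℤ → ℤ
  | _, [], _ => 0
  | p, s :: l, c => s.cross p c + winding (s.move p) l c


theorem sum_Ico_one (N k : ℤ) (h : -N ≤ k) :
    ∑ _i ∈ Finset.Ico (-N) k, (1 : ℝ) = k + N := by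
  have h2 : ((k - -N).toNat : ℤ) = k + N := by omega
  have h3 : (((k - -N).toNat : ℤ) : ℝ) = k + N := by rw [h2]; push_cast; ring
  rw [Finset.sum_const, Int.card_Ico, nsmul_eq_mul, mul_one, ← h3]
  norm_cast

theorem sum_Ico_half (N k : ℤ) (h : -N ≤ k) :
    ∑ i ∈ Finset.Ico (-N) k, ((i : ℝ) + 1 / 2) = ((k : ℝ) ^ 2 - (N : ℝ) ^ 2) / 2 := by
  induction k, h using Int.leInduction with
  | base => simp
  | succ k hk ih =>
    have : Finset.Ico (-N) (k + 1) = insert k (Finset.Ico (-N) k) := by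
      ext i; simp; omega
    rw [this, Finset.sum_insert (by simp), ih]
    push_cast; ring

/-- The squares in `[-N, N)²`. -/
noncomputable def box (N : ℤ) : Finset (ℤ × ℤ) := Finset.Ico (-N) N ×ˢ Finset.Ico (-N) N

theorem sum_box_row (N b k e : ℤ) (hb : -N ≤ b) (hb' : b < N) (hk' : k ≤ N) (f g : ℤ → ℝ) :
    ∑ c ∈ box N, ((if b = c.2 ∧ c.1 < k then e else 0 : ℤ) : ℝ) * (f c.1 * g c.2) =
      e * (∑ i ∈ Finset.Ico (-N) k, f i) * g b := by
  have h1 : Finset.Ico (-N) k = (Finset.Ico (-N) N).filter (fun i => i < k) := by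
    ext i; simp; omega
  rw [box, Finset.sum_product, h1, Finset.sum_filter, Finset.mul_sum, Finset.sum_mul]
  refine Finset.sum_congr rfl fun i _ => ?_
  rw [Finset.sum_eq_single b]
  · by_cases hi : i < k <;> simp [hi]; ring
  · intro j _ hj
    simp [Ne.symm hj]
  · intro h; exact absurd (Finset.mem_Ico.2 ⟨hb, hb'⟩) h

/-- Potentials whose increment along a step is the corresponding sum of crossings. -/
noncomputable def potArea (N : ℤ) (g : CartanReal) : ℝ := g.area + g.x * g.y / 2 + N * g.y
/-- See `potArea`. -/
noncomputable def potX (N : ℤ) (g : CartanReal) : ℝ := g.baryX + g.x ^ 2 * g.y / 6 - N ^ 2 * g.y / 2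
/-- See `potArea`. -/
noncomputable def potY (N : ℤ) (g : CartanReal) : ℝ := g.baryY + g.x * g.y ^ 2 / 3 + N * g.y ^ 2 / 2

theorem step_sums (N : ℤ) (s : Step) (p : ℤ × ℤ) (g : CartanReal)
    (hx : g.x = p.1) (hy : g.y = p.2) (h1 : -N < p.1) (h2 : p.1 < N) (h3 : -N < p.2) (h4 : p.2 < N) :
    (∑ c ∈ box N, (s.cross p c : ℝ) = potArea N (g * s.val) - potArea N g) ∧
    (∑ c ∈ box N, (s.cross p c : ℝ) * ((c.1 : ℝ) + 1 / 2) = potX N (g * s.val) - potX N g) ∧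
    (∑ c ∈ box N, (s.cross p c : ℝ) * ((c.2 : ℝ) + 1 / 2) = potY N (g * s.val) - potY N g) := by
  have key : ∀ b e : ℤ, -N ≤ b → b < N →
      (∑ c ∈ box N, ((if b = c.2 ∧ c.1 < p.1 then e else 0 : ℤ) : ℝ) = e * (p.1 + N)) ∧
      (∑ c ∈ box N, ((if b = c.2 ∧ c.1 < p.1 then e else 0 : ℤ) : ℝ) * ((c.1 : ℝ) + 1 / 2)
        = e * (((p.1 : ℝ) ^ 2 - (N : ℝ) ^ 2) / 2)) ∧
      (∑ c ∈ box N, ((if b = c.2 ∧ c.1 < p.1 then e else 0 : ℤ) : ℝ) * ((c.2 : ℝ) + 1 / 2)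
        = e * (p.1 + N) * (b + 1 / 2)) := by
    intro b e hb hb'
    have r := sum_box_row N b p.1 e hb hb' h2.le
    refine ⟨?_, ?_, ?_⟩
    · have := r (fun _ => 1) (fun _ => 1)
      rw [sum_Ico_one N p.1 h1.le] at this
      simpa only [mul_one] using this
    · have := r (fun i => (i : ℝ) + 1 / 2) (fun _ => 1)
      rw [sum_Ico_half N p.1 h1.le] at this
      simpa only [mul_one] using this
    · have := r (fun _ => 1) (fun j => (j : ℝ) + 1 / 2)
      rw [sum_Ico_one N p.1 h1.le] at this
      simpa only [one_mul] using this
  cases s with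
  | east =>
    simp only [Step.cross, Step.val, potArea, potX, potY, CartanReal.genX, CartanReal.mul_x,
      CartanReal.mul_y, CartanReal.mul_area, CartanReal.mul_baryX, CartanReal.mul_baryY,
      CartanReal.det, Int.cast_zero, zero_mul, Finset.sum_const_zero]
    refine ⟨?_, ?_, ?_⟩ <;> ring
  | west =>
    simp only [Step.cross, Step.val, potArea, potX, potY, CartanReal.genX, CartanReal.mul_x,
      CartanReal.mul_y, CartanReal.mul_area, CartanReal.mul_baryX, CartanReal.mul_baryY,
      CartanReal.det, Int.cast_zero, zero_mul, Finset.sum_const_zero, CartanReal.inv_x,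
      CartanReal.inv_y, CartanReal.inv_area, CartanReal.inv_baryX, CartanReal.inv_baryY]
    refine ⟨?_, ?_, ?_⟩ <;> ring
  | north =>
    obtain ⟨k1, k2, k3⟩ := key p.2 1 h3.le h4
    simp only [Step.cross, k1, k2, k3, Step.val, potArea, potX, potY, CartanReal.genY,
      CartanReal.mul_x, CartanReal.mul_y, CartanReal.mul_area, CartanReal.mul_baryX,
      CartanReal.mul_baryY, CartanReal.det, hx, hy, Int.cast_one]
    refine ⟨?_, ?_, ?_⟩ <;> ring
  | south =>
    obtain ⟨k1, k2, k3⟩ := key (p.2 - 1) (-1) (by omega) (by omega)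
    simp only [Step.cross, k1, k2, k3, Step.val, potArea, potX, potY, CartanReal.genY,
      CartanReal.mul_x, CartanReal.mul_y, CartanReal.mul_area, CartanReal.mul_baryX,
      CartanReal.mul_baryY, CartanReal.det, hx, hy, Int.cast_one, Int.cast_neg, Int.cast_sub,
      CartanReal.inv_x, CartanReal.inv_y, CartanReal.inv_area, CartanReal.inv_baryX,
      CartanReal.inv_baryY]
    refine ⟨?_, ?_, ?_⟩ <;> ring

theorem step_hat (s : Step) (p : ℤ × ℤ) (g : CartanReal) (hx : g.x = p.1) (hy : g.y = p.2) :
    (g * s.val).x = (s.move p).1 ∧ (g * s.val).y = (s.move p).2 := by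
  cases s <;> simp [Step.val, Step.move, CartanReal.genX, CartanReal.genY, hx, hy] <;> ring

theorem path_sums (N : ℤ) (l : List Step) : ∀ (p : ℤ × ℤ) (g : CartanReal),
    g.x = p.1 → g.y = p.2 → (l.length - N < p.1 ∧ p.1 < N - l.length) →
    (l.length - N < p.2 ∧ p.2 < N - l.length) →
    (∑ c ∈ box N, (winding p l c : ℝ) =
      potArea N (g * (l.map Step.val).prod) - potArea N g) ∧
    (∑ c ∈ box N, (winding p l c : ℝ) * ((c.1 : ℝ) + 1 / 2) =
      potX N (g * (l.map Step.val).prod) - potX N g) ∧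
    (∑ c ∈ box N, (winding p l c : ℝ) * ((c.2 : ℝ) + 1 / 2) =
      potY N (g * (l.map Step.val).prod) - potY N g) ∧
    (g * (l.map Step.val).prod).x = (endpoint p l).1 ∧
    (g * (l.map Step.val).prod).y = (endpoint p l).2 ∧
    (∀ c ∉ box N, winding p l c =
      if c.1 < -N then
        (if c.2 < (endpoint p l).2 then 1 else 0) - (if c.2 < p.2 then 1 else 0) else 0) := by
  induction l with
  | nil =>
    intro p g hx hy _ _
    refine ⟨?_, ?_, ?_, ?_, ?_, ?_⟩
    · simp [winding]
    · simp [winding]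
    · simp [winding]
    · simp [endpoint, hx]
    · simp [endpoint, hy]
    · intro c _
      simp only [winding, endpoint]
      by_cases h : c.2 < p.2 <;> simp [h]
  | cons s l ih =>
    intro p g hx hy h1 h2
    rw [List.length_cons] at h1 h2
    push_cast at h1 h2
    obtain ⟨mx, my⟩ := step_hat s p g hx hy
    have b1 : l.length - N < (s.move p).1 ∧ (s.move p).1 < N - l.length := by
      cases s <;> simp only [Step.move] <;> omega
    have b2 : l.length - N < (s.move p).2 ∧ (s.move p).2 < N - l.length := by
      cases s <;> simp only [Step.move] <;> omega
    obtain ⟨i1, i2, i3, i4, i5, i6⟩ := ih (s.move p) (g * s.val) mx my b1 b2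
    obtain ⟨s1, s2, s3⟩ := step_sums N s p g hx hy (by omega) (by omega) (by omega) (by omega)
    simp only [List.map_cons, List.prod_cons, winding, endpoint, Int.cast_add, add_mul,
      Finset.sum_add_distrib, s1, s2, s3, ← mul_assoc, i1, i2, i3, i4, i5]
    refine ⟨by ring, by ring, by ring, trivial, trivial, ?_⟩
    intro c hc
    rw [i6 c hc]
    have hc' : ¬ ((-N ≤ c.1 ∧ c.1 < N) ∧ (-N ≤ c.2 ∧ c.2 < N)) := by
      simpa [box, Finset.mem_product] using hc
    cases s <;> simp only [Step.move, Step.cross] <;> split_ifs <;> omega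

/-- For a closed lattice path, the coordinates of the group element are the integrals
`∬ w`, `∬ x w`, `∬ y w` of the winding number `w` of the path. -/
theorem area_bary_eq_winding (l : List Step) (hl : endpoint (0, 0) l = (0, 0)) :
    (l.map Step.val).prod.hat = (0, 0) ∧
    (l.map Step.val).prod.area = ∑ᶠ c : ℤ × ℤ, (winding (0, 0) l c : ℝ) ∧
    (l.map Step.val).prod.bary =
      (∑ᶠ c : ℤ × ℤ, (winding (0, 0) l c : ℝ) * ((c.1 : ℝ) + 1 / 2),
        ∑ᶠ c : ℤ × ℤ, (winding (0, 0) l c : ℝ) * ((c.2 : ℝ) + 1 / 2)) := by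
  obtain ⟨i1, i2, i3, i4, i5, i6⟩ := path_sums (l.length + 1) l (0, 0) 1 (by simp) (by simp)
    (by simp) (by simp)
  have hz : ∀ c : ℤ × ℤ, c ∉ box (l.length + 1) → winding (0, 0) l c = 0 := by
    intro c hc
    rw [i6 c hc, hl]
    simp
  have hs : ∀ f : ℤ × ℤ → ℝ, (Function.support fun c => (winding (0, 0) l c : ℝ) * f c) ⊆
      ↑(box (l.length + 1)) := by
    intro f c hc
    by_contra h
    exact hc (by simp [hz c h])
  have hs1 := hs (fun _ => 1)
  simp only [mul_one] at hs1
  rw [hl] at i4 i5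
  simp only [one_mul, Int.cast_zero] at i1 i2 i3 i4 i5
  rw [finsum_eq_sum_of_support_subset _ hs1, finsum_eq_sum_of_support_subset _ (hs _),
    finsum_eq_sum_of_support_subset _ (hs _), i1, i2, i3]
  simp [CartanReal.hat, CartanReal.bary, potArea, potX, potY, i4, i5]

end Cartan

/-! By the symmetries of the square grid one may assume `0 ≤ u.2 ≤ u.1`, so that the ray moves east
and north. A word has length equal to the increase of `x + y` plus twice the number of its west and
south steps (`backs`). Hence the ray is geodesic, the differences `d(γ_n, g) - n` are non-increasing
and bounded below, and the limit exists. For a loop `h`, the question is how many backward steps a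
word for `h⁻¹γ_n` needs.

Lower bound. After a correction linear in the endpoint data is replaced by `prim`, the barycenter
across `u` varies along a path by `-½∫ across² d(along)`. Adding a function `E` of the endpoint only
(`exists_potential`), it becomes a quantity that vertical steps preserve, that an east step lowers
by `excess ≥ 0`, and that a west step raises by the corresponding amount. The ray loses nothing,
since its east steps have heights in `[0, u.1]`, where `excess` vanishes. So for a word of `h⁻¹γ_n`
the total loss is exactly `baryAcross u h`, and a negative value must be gained on west steps. If
the word stays within distance `T` of the line and has `k` backward steps, the gain is at most
`k(T+2)²`. But going out to distance `T` and back forces a loss of order `T³`, unless backward steps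
reduce it by order `kT²`. Hence the net gain is `O(k³)` (`neg_slackSum_le_cube`), which gives the
cube root.

Upper bound. A modification of the ray by a loop `f` with `k` extra steps (`Move`) gives `b(h) ≤
‖h⁻¹f⁻¹‖ + k` (`busemann_le_of_move`). Thus it suffices to bring the area and the barycenter of `f`
within a bounded distance of those of `h⁻¹`, because only finitely many loops remain
(`exists_norm_le_of_bounded`). Area, barycenter along `u` and negative barycenter across `u` can all
be adjusted at bounded cost by shifting long portions of the ray. A positive barycenter `N` across
`u` costs `O(N^(1/3))`, by displacing rectangles of side about `N^(1/3)`. Adjusting the area by `a`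
in this way disturbs the barycenter across `u` by `O(|a|)`, hence the term `|A(h)|`.

That term disappears when the ray has corners whose squares have centers arbitrarily close to the
line, infinitely often and on both sides: flipping a corner is free, changes the area by `±1` and
the barycenter across `u` by the height of the center. For irrational slope this is density of a
circle rotation. For `[a:b]` with `a, b` odd, centers lie on the line and the alternating rule
serves both sides; there also `B` takes values in a lattice, so that the additive constant can be
absorbed. -/

namespace CartanReal

/-! ### Algebra of loops. -/

/-- The elements with trivial second endpoint. -/
def IsLoop (g : CartanReal) : Prop := g.x = 0 ∧ g.y = 0

theorem inv_eq_of_isLoop {g : CartanReal} (hg : g.IsLoop) :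
    (g⁻¹).area = -g.area ∧ (g⁻¹).baryX = -g.baryX ∧ (g⁻¹).baryY = -g.baryY := by
  obtain ⟨h1, h2⟩ := hg
  simp [h1, h2]

theorem IsLoop.inv {g : CartanReal} (hg : g.IsLoop) : (g⁻¹).IsLoop := by
  obtain ⟨h1, h2⟩ := hg
  simp [IsLoop, h1, h2]

theorem IsLoop.mul {g h : CartanReal} (hg : g.IsLoop) (hh : h.IsLoop) : (g * h).IsLoop := by
  obtain ⟨h1, h2⟩ := hg
  obtain ⟨h3, h4⟩ := hh
  simp [IsLoop, h1, h2, h3, h4]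

theorem loop_mul {g : CartanReal} (hg : g.IsLoop) (h : CartanReal) :
    (g * h).x = h.x ∧ (g * h).y = h.y ∧ (g * h).area = g.area + h.area ∧
      (g * h).baryX = g.baryX + h.baryX ∧ (g * h).baryY = g.baryY + h.baryY := by
  obtain ⟨h1, h2⟩ := hg
  simp [mul_area, mul_baryX, mul_baryY, det, h1, h2]

/-- Conjugation by `g` translates the loop by `ĝ`: winding numbers are carried along, so only the
barycenter changes, by `A(c) ĝ`. -/
theorem IsLoop.conj {c : CartanReal} (hc : c.IsLoop) (g : CartanReal) :
    (g * c * g⁻¹).IsLoop ∧ (g * c * g⁻¹).area = c.area ∧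
      (g * c * g⁻¹).baryX = c.baryX + g.x * c.area ∧
      (g * c * g⁻¹).baryY = c.baryY + g.y * c.area := by
  obtain ⟨h1, h2⟩ := hc
  refine ⟨⟨?_, ?_⟩, ?_, ?_, ?_⟩ <;>
    simp only [mul_x, mul_y, mul_area, mul_baryX, mul_baryY, det, inv_x, inv_y, inv_area,
      inv_baryX, inv_baryY, h1, h2] <;> ring

/-- Without area, the barycenter does not feel translations, so such loops are central. -/
theorem IsLoop.commute {c : CartanReal} (hc : c.IsLoop) (hA : c.area = 0) (g : CartanReal) :
    g * c = c * g := by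
  obtain ⟨h1, h2⟩ := hc
  ext <;> simp only [mul_x, mul_y, mul_area, mul_baryX, mul_baryY, det, h1, h2, hA] <;> ring

theorem genX_zpow (n : ℤ) : genX ^ n = { x := n, y := 0, area := 0, baryX := 0, baryY := 0 } := by
  induction n using Int.induction_on with
  | zero => ext <;> simp
  | succ n ih =>
    rw [zpow_add_one, ih]
    ext <;> simp [genX, mul_area, mul_baryX, mul_baryY, det]
  | pred n ih =>
    rw [zpow_sub_one, ih]
    ext <;> simp [genX, mul_area, mul_baryX, mul_baryY, det]
    ring

theorem genY_zpow (n : ℤ) : genY ^ n = { x := 0, y := n, area := 0, baryX := 0, baryY := 0 } := by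
  induction n using Int.induction_on with
  | zero => ext <;> simp
  | succ n ih =>
    rw [zpow_add_one, ih]
    ext <;> simp [genY, mul_area, mul_baryX, mul_baryY, det]
  | pred n ih =>
    rw [zpow_sub_one, ih]
    ext <;> simp [genY, mul_area, mul_baryX, mul_baryY, det]
    ring

end CartanReal

namespace Cartan

/-! ### Word length and integrality of the coordinates. -/

theorem exists_list_of_mem_S (g : Cartan) : ∃ l : List Cartan, (∀ s ∈ l, s ∈ S) ∧ l.prod = g := by
  have hg := g.2
  rw [← Subgroup.mem_toSubmonoid, Subgroup.closure_toSubmonoid] at hg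
  obtain ⟨l, hl, hp⟩ := Submonoid.exists_list_of_mem_closure hg
  have key : ∀ l : List CartanReal,
      (∀ y ∈ l, y ∈ ({CartanReal.genX, CartanReal.genY} : Set CartanReal) ∨
        y⁻¹ ∈ ({CartanReal.genX, CartanReal.genY} : Set CartanReal)) →
      ∃ l' : List Cartan, (∀ s ∈ l', s ∈ S) ∧ (l'.prod : CartanReal) = l.prod := by
    intro l
    induction l with
    | nil => exact fun _ => ⟨[], by simp, by simp⟩
    | cons a l ih =>
      intro h
      obtain ⟨l', h1, h2⟩ := ih fun y hy => h y (List.mem_cons_of_mem _ hy)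
      have h3 : ∃ s ∈ S, (s : CartanReal) = a := by
        rcases h a List.mem_cons_self with (h | h) | (h | h)
        · exact ⟨X, by simp [S], h.symm⟩
        · exact ⟨Y, by simp [S], h.symm⟩
        · exact ⟨X⁻¹, by simp [S], (inv_eq_iff_eq_inv.1 h).symm⟩
        · exact ⟨Y⁻¹, by simp [S], (inv_eq_iff_eq_inv.1 h).symm⟩
      obtain ⟨s, hs, rfl⟩ := h3
      refine ⟨s :: l', ?_, by rw [List.prod_cons, List.prod_cons, ← h2]; rfl⟩
      intro t ht
      rcases List.mem_cons.1 ht with rfl | ht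
      exacts [hs, h1 t ht]
  obtain ⟨l', h1, h2⟩ := key l hl
  exact ⟨l', h1, Subtype.ext (h2.trans hp)⟩

theorem exists_list_length_eq_norm (g : Cartan) :
    ∃ l : List Cartan, l.length = norm g ∧ (∀ s ∈ l, s ∈ S) ∧ l.prod = g := by
  obtain ⟨l, h1, h2⟩ := exists_list_of_mem_S g
  exact Nat.sInf_mem (s := {n : ℕ | ∃ l : List Cartan, l.length = n ∧ (∀ s ∈ l, s ∈ S) ∧ l.prod = g})
    ⟨_, l, rfl, h1, h2⟩

theorem norm_prod_le (l : List Cartan) (h : ∀ s ∈ l, s ∈ S) : norm l.prod ≤ l.length :=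
  Nat.sInf_le ⟨l, rfl, h, rfl⟩

theorem norm_mul_le (g h : Cartan) : norm (g * h) ≤ norm g + norm h := by
  obtain ⟨l, h1, h2, rfl⟩ := exists_list_length_eq_norm g
  obtain ⟨l', h1', h2', rfl⟩ := exists_list_length_eq_norm h
  rw [← h1, ← h1', ← List.prod_append, ← List.length_append]
  apply norm_prod_le
  intro s hs
  rcases List.mem_append.1 hs with hs | hs
  exacts [h2 s hs, h2' s hs]

theorem norm_one : norm 1 = 0 := Nat.le_zero.1 (norm_prod_le [] (by simp))

theorem norm_le_one {s : Cartan} (hs : s ∈ S) : norm s ≤ 1 := by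
  simpa using norm_prod_le [s] (by simpa using hs)

theorem inv_mem_S {s : Cartan} (hs : s ∈ S) : s⁻¹ ∈ S := by
  rcases hs with rfl | rfl | rfl | rfl <;> simp [S]

theorem norm_inv_le (g : Cartan) : norm g⁻¹ ≤ norm g := by
  obtain ⟨l, h1, h2, rfl⟩ := exists_list_length_eq_norm g
  rw [← h1, List.prod_inv_reverse]
  have := norm_prod_le (l.map (fun x => x⁻¹)).reverse (by
    intro s hs
    simp only [List.mem_reverse, List.mem_map] at hs
    obtain ⟨t, ht, rfl⟩ := hs
    exact inv_mem_S (h2 t ht))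
  simpa using this

theorem norm_inv (g : Cartan) : norm g⁻¹ = norm g :=
  le_antisymm (norm_inv_le g) (by simpa using norm_inv_le g⁻¹)

theorem norm_pow_le (g : Cartan) (n : ℕ) : norm (g ^ n) ≤ n * norm g := by
  induction n with
  | zero => simp [norm_one]
  | succ n ih =>
    rw [pow_succ, add_mul, one_mul]
    exact (norm_mul_le _ _).trans (by omega)

theorem norm_zpow_le (g : Cartan) (n : ℤ) : norm (g ^ n) ≤ n.natAbs * norm g := by
  rcases Int.natAbs_eq n with h | h
  · conv_lhs => rw [h, zpow_natCast]
    exact norm_pow_le g _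
  · conv_lhs => rw [h, zpow_neg, zpow_natCast, norm_inv]
    exact norm_pow_le g _

theorem norm_X_le : norm X ≤ 1 := norm_le_one (by simp [S])

theorem norm_Y_le : norm Y ≤ 1 := norm_le_one (by simp [S])

theorem norm_X_zpow_le (n : ℤ) : norm (X ^ n) ≤ n.natAbs :=
  (norm_zpow_le X n).trans (by have := norm_X_le; nlinarith [n.natAbs.zero_le])

theorem norm_Y_zpow_le (n : ℤ) : norm (Y ^ n) ≤ n.natAbs :=
  (norm_zpow_le Y n).trans (by have := norm_Y_le; nlinarith [n.natAbs.zero_le])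

/-- A geodesic word, as a list of steps. -/
theorem exists_steps (g : Cartan) :
    ∃ l : List Step, l.length = norm g ∧ (l.map Step.val).prod = g.1 := by
  obtain ⟨l, h1, h2, rfl⟩ := exists_list_length_eq_norm g
  rw [← h1]
  clear h1
  induction l with
  | nil => exact ⟨[], by simp, by simp⟩
  | cons a l ih =>
    obtain ⟨l', h3, h4⟩ := ih fun s hs => h2 s (List.mem_cons_of_mem _ hs)
    have h5 : ∃ s : Step, s.val = a.1 := by
      rcases h2 a List.mem_cons_self with rfl | rfl | rfl | rfl
      exacts [⟨.east, rfl⟩, ⟨.west, rfl⟩, ⟨.north, rfl⟩, ⟨.south, rfl⟩]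
    obtain ⟨s, hs⟩ := h5
    exact ⟨s :: l', by simp [h3], by simp [h4, hs]⟩

/-- The coordinates of elements of the Cartan group are integers, up to the factors `2` and `6`. -/
theorem exists_int_coords (g : Cartan) : ∃ m n a b c : ℤ, g.1.x = m ∧ g.1.y = n ∧
    2 * g.1.area = a ∧ 6 * g.1.baryX = b ∧ 6 * g.1.baryY = c := by
  obtain ⟨g, hg⟩ := g
  dsimp only
  induction hg using Subgroup.closure_induction with
  | mem x hx =>
    rcases hx with rfl | rfl
    · exact ⟨1, 0, 0, 0, 0, by simp [CartanReal.genX]⟩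
    · exact ⟨0, 1, 0, 0, 0, by simp [CartanReal.genY]⟩
  | one => exact ⟨0, 0, 0, 0, 0, by simp⟩
  | mul g h _ _ hg hh =>
    obtain ⟨m, n, a, b, c, h1, h2, h3, h4, h5⟩ := hg
    obtain ⟨m', n', a', b', c', h1', h2', h3', h4', h5'⟩ := hh
    refine ⟨m + m', n + n', a + a' + (m * n' - n * m'),
      b + b' + 3 * m * a' + (2 * m + m') * (m * n' - n * m'),
      c + c' + 3 * n * a' + (2 * n + n') * (m * n' - n * m'), ?_⟩
    push_cast
    simp only [CartanReal.mul_x, CartanReal.mul_y, CartanReal.mul_area, CartanReal.mul_baryX,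
      CartanReal.mul_baryY, CartanReal.det, ← h1, ← h2, ← h3, ← h4, ← h5, ← h1', ← h2', ← h3',
      ← h4', ← h5']
    refine ⟨trivial, trivial, by ring, by ring, by ring⟩
  | inv g _ hg =>
    obtain ⟨m, n, a, b, c, h1, h2, h3, h4, h5⟩ := hg
    refine ⟨-m, -n, -a, -b + 3 * m * a, -c + 3 * n * a, ?_⟩
    push_cast
    simp only [CartanReal.inv_x, CartanReal.inv_y, CartanReal.inv_area, CartanReal.inv_baryX,
      CartanReal.inv_baryY, ← h1, ← h2, ← h3, ← h4, ← h5]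
    refine ⟨trivial, trivial, by ring, by ring, by ring⟩

/-- Loops with bounded area and barycenter have bounded word length. -/
theorem exists_norm_le_of_bounded (R : ℝ) : ∃ M : ℕ, ∀ g : Cartan, g.1.IsLoop →
    |g.1.area| ≤ R → |g.1.baryX| ≤ R → |g.1.baryY| ≤ R → norm g ≤ M := by
  set T : Set Cartan := {g | g.1.IsLoop ∧ |g.1.area| ≤ R ∧ |g.1.baryX| ≤ R ∧ |g.1.baryY| ≤ R}
  have hT : T.Finite := by
    -- The floors are exact by `exists_int_coords`, so this embeds `T` into a finite box of integer
    -- triples.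
    let f : Cartan → ℤ × ℤ × ℤ := fun g => (⌊2 * g.1.area⌋, ⌊6 * g.1.baryX⌋, ⌊6 * g.1.baryY⌋)
    have hfl : ∀ g : Cartan, ((f g).1 : ℝ) = 2 * g.1.area ∧ ((f g).2.1 : ℝ) = 6 * g.1.baryX ∧
        ((f g).2.2 : ℝ) = 6 * g.1.baryY := by
      intro g
      obtain ⟨m, n, a, b, c, h1, h2, h3, h4, h5⟩ := exists_int_coords g
      simp [f, h3, h4, h5]
    have hinj : Set.InjOn f T := by
      intro g hg h hh hgh
      obtain ⟨a1, a2, a3⟩ := hfl g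
      obtain ⟨b1, b2, b3⟩ := hfl h
      rw [hgh] at a1 a2 a3
      apply Subtype.ext
      ext
      · rw [hg.1.1, hh.1.1]
      · rw [hg.1.2, hh.1.2]
      · linarith
      · linarith
      · linarith
    refine Set.Finite.of_finite_image (Set.Finite.subset (Set.finite_Icc
      ((-⌈6 * R⌉, -⌈6 * R⌉, -⌈6 * R⌉) : ℤ × ℤ × ℤ) (⌈6 * R⌉, ⌈6 * R⌉, ⌈6 * R⌉)) ?_) hinj
    rintro _ ⟨g, ⟨_, h1, h2, h3⟩, rfl⟩
    obtain ⟨a1, a2, a3⟩ := hfl g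
    have hc := Int.le_ceil (6 * R)
    have h1' := abs_le.1 h1
    have h2' := abs_le.1 h2
    have h3' := abs_le.1 h3
    refine ⟨⟨?_, ?_, ?_⟩, ⟨?_, ?_, ?_⟩⟩ <;> simp only [] <;> rify <;> linarith
  obtain ⟨M, hM⟩ := (hT.image norm).bddAbove
  exact ⟨M, fun g h1 h2 h3 h4 => hM ⟨g, ⟨h1, h2, h3, h4⟩, rfl⟩⟩

theorem coe_X : (X : CartanReal) = CartanReal.genX := rfl

theorem coe_Y : (Y : CartanReal) = CartanReal.genY := rfl

/-! ### Coordinates along and across the direction `u` -/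

/-- The coordinate of the endpoint along `u`. -/
def along (u : ℝ × ℝ) (g : CartanReal) : ℝ := g.x * u.1 + g.y * u.2

/-- The coordinate of the endpoint along `u^⊥`. -/
def across (u : ℝ × ℝ) (g : CartanReal) : ℝ := g.y * u.1 - g.x * u.2

/-- The coordinate of the barycenter along `u`. -/
def baryAlong (u : ℝ × ℝ) (g : CartanReal) : ℝ := g.baryX * u.1 + g.baryY * u.2

/-- The coordinate of the barycenter along `u^⊥`. -/
def baryAcross (u : ℝ × ℝ) (g : CartanReal) : ℝ := g.baryY * u.1 - g.baryX * u.2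

/-- The coordinate along `u^⊥` of the center of the square to the upper right of `p`. -/
noncomputable def height (u : ℝ × ℝ) (p : ℤ × ℤ) : ℝ := (p.2 + 1 / 2) * u.1 - (p.1 + 1 / 2) * u.2

theorem side_eq_height {u : ℝ × ℝ} (h1 : 0 ≤ u.1) (h2 : 0 ≤ u.2) (p : ℤ × ℤ) :
    side u p = height u p := by
  simp [side, orient, h1, h2, nextCenter, dot, perp, height]
  ring

theorem rayHat_zero (u : ℝ × ℝ) (τ : Bool) : rayHat u τ 0 = (0, 0) := rfl

/-- A step of the ray, with the evolution of the alternating Boolean. -/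
theorem rayState_succ {u : ℝ × ℝ} (h1 : 0 ≤ u.1) (h2 : 0 ≤ u.2) (τ : Bool) (n : ℕ) :
    (rayHat u τ (n + 1) = ((rayHat u τ n).1 + 1, (rayHat u τ n).2) ∧
      (0 < height u (rayHat u τ n) ∧ (rayState u τ (n + 1)).2 = (rayState u τ n).2 ∨
        height u (rayHat u τ n) = 0 ∧ (rayState u τ n).2 = true ∧
          (rayState u τ (n + 1)).2 = false)) ∨
    (rayHat u τ (n + 1) = ((rayHat u τ n).1, (rayHat u τ n).2 + 1) ∧
      (height u (rayHat u τ n) < 0 ∧ (rayState u τ (n + 1)).2 = (rayState u τ n).2 ∨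
        height u (rayHat u τ n) = 0 ∧ (rayState u τ n).2 = false ∧
          (rayState u τ (n + 1)).2 = true)) := by
  have hs := side_eq_height h1 h2 (rayState u τ n).1
  have e1 : orient u.1 = 1 := by simp [orient, h1]
  have e2 : orient u.2 = 1 := by simp [orient, h2]
  simp only [rayHat, rayState, ← hs, e1, e2]
  rcases lt_trichotomy (side u (rayState u τ n).1) 0 with h | h | h
  · simp [h, h.not_gt]
  · cases ht : (rayState u τ n).2 <;> simp [h]
  · simp [h]

theorem rayHat_succ {u : ℝ × ℝ} (h1 : 0 ≤ u.1) (h2 : 0 ≤ u.2) (τ : Bool) (n : ℕ) :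
    (rayHat u τ (n + 1) = ((rayHat u τ n).1 + 1, (rayHat u τ n).2) ∧
      rayPath u τ (n + 1) = rayPath u τ n * X ∧ 0 ≤ height u (rayHat u τ n)) ∨
    (rayHat u τ (n + 1) = ((rayHat u τ n).1, (rayHat u τ n).2 + 1) ∧
      rayPath u τ (n + 1) = rayPath u τ n * Y ∧ height u (rayHat u τ n) ≤ 0) := by
  rcases rayState_succ h1 h2 τ n with ⟨h, h'⟩ | ⟨h, h'⟩
  · left
    refine ⟨h, ?_, ?_⟩
    · simp [rayPath, h]
    · rcases h' with h' | h' <;> linarith [h'.1]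
  · right
    refine ⟨h, ?_, ?_⟩
    · simp [rayPath, h]
    · rcases h' with h' | h' <;> linarith [h'.1]

theorem rayPath_coords {u : ℝ × ℝ} (h1 : 0 ≤ u.1) (h2 : 0 ≤ u.2) (τ : Bool) (n : ℕ) :
    (rayPath u τ n).1.x = (rayHat u τ n).1 ∧ (rayPath u τ n).1.y = (rayHat u τ n).2 := by
  induction n with
  | zero => simp [rayPath, rayHat_zero]
  | succ n ih =>
    rcases rayHat_succ h1 h2 τ n with ⟨h, h', _⟩ | ⟨h, h', _⟩ <;>
      simp [h, h', ih, coe_X, coe_Y, CartanReal.genX, CartanReal.genY]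

theorem rayHat_sum {u : ℝ × ℝ} (h1 : 0 ≤ u.1) (h2 : 0 ≤ u.2) (τ : Bool) (n : ℕ) :
    (rayHat u τ n).1 + (rayHat u τ n).2 = n := by
  induction n with
  | zero => simp [rayHat_zero]
  | succ n ih =>
    rcases rayHat_succ h1 h2 τ n with ⟨h, _⟩ | ⟨h, _⟩ <;> simp only [h] <;> push_cast <;> omega

/-- The walk corrects itself: it goes down by `u.2` only from a height `≥ 0`, and up by `u.1` only
from a height `≤ 0`. -/
theorem rayHat_height {u : ℝ × ℝ} (h1 : 0 ≤ u.1) (h2 : 0 ≤ u.2) (τ : Bool) (n : ℕ) :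
    -u.2 ≤ height u (rayHat u τ n) ∧ height u (rayHat u τ n) ≤ u.1 := by
  induction n with
  | zero => simp only [rayHat_zero, height, Int.cast_zero]; constructor <;> linarith
  | succ n ih =>
    rcases rayHat_succ h1 h2 τ n with ⟨h, _, h'⟩ | ⟨h, _, h'⟩ <;> rw [h] <;>
      simp only [height, Int.cast_add, Int.cast_one] at ih h' ⊢ <;> constructor <;> linarith

theorem across_eq_height {u : ℝ × ℝ} (h1 : 0 ≤ u.1) (h2 : 0 ≤ u.2) (τ : Bool) (n : ℕ) :
    across u (rayPath u τ n).1 = height u (rayHat u τ n) - (u.1 - u.2) / 2 := by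
  obtain ⟨h3, h4⟩ := rayPath_coords h1 h2 τ n
  rw [across, h3, h4, height]
  ring

theorem norm_rayPath_between {u : ℝ × ℝ} (h1 : 0 ≤ u.1) (h2 : 0 ≤ u.2) (τ : Bool) (i k : ℕ) :
    norm ((rayPath u τ i)⁻¹ * rayPath u τ (i + k)) ≤ k := by
  induction k with
  | zero => simp [norm_one]
  | succ k ih =>
    rw [← add_assoc]
    have : ∃ s, norm s ≤ 1 ∧ rayPath u τ (i + k + 1) = rayPath u τ (i + k) * s := by
      rcases rayHat_succ h1 h2 τ (i + k) with ⟨_, h, _⟩ | ⟨_, h, _⟩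
      exacts [⟨X, norm_X_le, h⟩, ⟨Y, norm_Y_le, h⟩]
    obtain ⟨s, hs, h⟩ := this
    rw [h, ← mul_assoc]
    exact (norm_mul_le _ _).trans (by omega)

theorem x_add_y_prod_le_length (l : List Step) :
    (l.map Step.val).prod.x + (l.map Step.val).prod.y ≤ l.length := by
  induction l with
  | nil => simp
  | cons s l ih =>
    have : s.val.x + s.val.y ≤ 1 := by
      cases s <;> norm_num [Step.val, CartanReal.genX, CartanReal.genY]
    simp only [List.map_cons, List.prod_cons, CartanReal.mul_x, CartanReal.mul_y, List.length_cons]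
    push_cast
    linarith

/-- This makes the ray geodesic, and makes the Busemann function non-negative on loops, which do not
move endpoints. -/
theorem add_le_norm (g : Cartan) : g.1.x + g.1.y ≤ norm g := by
  obtain ⟨l, hl, h⟩ := exists_steps g
  rw [← hl, ← h]
  exact x_add_y_prod_le_length l

theorem norm_rayPath {u : ℝ × ℝ} (h1 : 0 ≤ u.1) (h2 : 0 ≤ u.2) (τ : Bool) (n : ℕ) :
    norm (rayPath u τ n) = n := by
  apply le_antisymm
  · simpa [rayPath] using norm_rayPath_between h1 h2 τ 0 n
  · have := add_le_norm (rayPath u τ n)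
    obtain ⟨h3, h4⟩ := rayPath_coords h1 h2 τ n
    have h5 := rayHat_sum h1 h2 τ n
    have h6 : ((rayHat u τ n).1 + (rayHat u τ n).2 : ℝ) = n := by exact_mod_cast h5
    rw [h3, h4, h6] at this
    exact_mod_cast this

theorem dist_rayPath_one {u : ℝ × ℝ} (h1 : 0 ≤ u.1) (h2 : 0 ≤ u.2) (τ : Bool) (n : ℕ) :
    dist (rayPath u τ n) 1 = n := by
  rw [dist, mul_one, norm_inv, norm_rayPath h1 h2]

theorem dist_rayPath (u : ℝ × ℝ) (τ : Bool) (n : ℕ) (g : Cartan) :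
    dist (rayPath u τ n) g = norm (g⁻¹ * rayPath u τ n) := by
  rw [dist, ← norm_inv]
  simp

/-- The horofunction limit exists along the ray. -/
theorem tendsto_busemann {u : ℝ × ℝ} (h1 : 0 ≤ u.1) (h2 : 0 ≤ u.2) (τ : Bool) (g : Cartan) :
    Tendsto (fun n : ℕ => (dist (rayPath u τ n) g : ℝ) - (dist (rayPath u τ n) 1 : ℝ))
      atTop (𝓝 (busemann (rayPath u τ) g)) := by
  -- The ray is geodesic and one more step changes `d(γ_n, g)` by at most `1`, so the differences
  -- are non-increasing; the triangle inequality bounds them below by `-‖g‖`.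
  refine tendsto_nhds_limUnder ⟨_, tendsto_atTop_ciInf ?_ ?_⟩
  · refine antitone_nat_of_succ_le fun n => ?_
    simp only [dist_rayPath_one h1 h2, dist_rayPath]
    have h3 : norm (g⁻¹ * rayPath u τ (n + 1)) ≤ norm (g⁻¹ * rayPath u τ n) + 1 := by
      have := norm_mul_le (g⁻¹ * rayPath u τ n) ((rayPath u τ n)⁻¹ * rayPath u τ (n + 1))
      rw [mul_assoc, mul_inv_cancel_left] at this
      exact this.trans (by have := norm_rayPath_between h1 h2 τ n 1; omega)
    have : (norm (g⁻¹ * rayPath u τ (n + 1)) : ℝ) ≤ norm (g⁻¹ * rayPath u τ n) + 1 := by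
      exact_mod_cast h3
    push_cast
    linarith
  · refine ⟨-norm g, ?_⟩
    rintro _ ⟨n, rfl⟩
    simp only [dist_rayPath_one h1 h2, dist_rayPath]
    have h3 : norm (rayPath u τ n) ≤ norm g + norm (g⁻¹ * rayPath u τ n) := by
      have := norm_mul_le g (g⁻¹ * rayPath u τ n)
      rwa [mul_inv_cancel_left] at this
    rw [norm_rayPath h1 h2] at h3
    have : (n : ℝ) ≤ norm g + norm (g⁻¹ * rayPath u τ n) := by exact_mod_cast h3
    linarith

theorem le_busemann {u : ℝ × ℝ} (h1 : 0 ≤ u.1) (h2 : 0 ≤ u.2) (τ : Bool) {g : Cartan} {c : ℝ}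
    (h : ∀ n : ℕ, n + c ≤ norm (g⁻¹ * rayPath u τ n)) : c ≤ busemann (rayPath u τ) g := by
  refine ge_of_tendsto (tendsto_busemann h1 h2 τ g) (Eventually.of_forall fun n => ?_)
  rw [dist_rayPath_one h1 h2, dist_rayPath]
  linarith [h n]

theorem busemann_le {u : ℝ × ℝ} (h1 : 0 ≤ u.1) (h2 : 0 ≤ u.2) (τ : Bool) {g : Cartan} {c : ℝ}
    (N : ℕ) (h : ∀ n : ℕ, N ≤ n → norm (g⁻¹ * rayPath u τ n) ≤ n + c) :
    busemann (rayPath u τ) g ≤ c := by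
  refine le_of_tendsto (tendsto_busemann h1 h2 τ g) (eventually_atTop.2 ⟨N, fun n hn => ?_⟩)
  rw [dist_rayPath_one h1 h2, dist_rayPath]
  linarith [h n hn]

theorem busemann_nonneg {u : ℝ × ℝ} (h1 : 0 ≤ u.1) (h2 : 0 ≤ u.2) (τ : Bool) {g : Cartan}
    (hg : g.1.IsLoop) : 0 ≤ busemann (rayPath u τ) g := by
  refine le_busemann h1 h2 τ fun n => ?_
  have h := add_le_norm (g⁻¹ * rayPath u τ n)
  obtain ⟨h3, h4⟩ := rayPath_coords h1 h2 τ n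
  have h5 : ((rayHat u τ n).1 + (rayHat u τ n).2 : ℝ) = n := by exact_mod_cast rayHat_sum h1 h2 τ n
  have h6 : (g⁻¹ * rayPath u τ n).1.x = (rayHat u τ n).1 := by simp [hg.1, h3]
  have h7 : (g⁻¹ * rayPath u τ n).1.y = (rayHat u τ n).2 := by simp [hg.2, h4]
  rw [h6, h7, h5] at h
  simpa using h

/-! ### The lower bound -/

/-- The convex piecewise linear function with `f (r + c) = f r + r` vanishing on `[0, c]`. -/
noncomputable def excess (c r : ℝ) : ℝ :=
  c * (⌊r / c⌋ * Int.fract (r / c) + ⌊r / c⌋ * (⌊r / c⌋ - 1) / 2)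

theorem excess_add {c : ℝ} (hc : 0 < c) (r : ℝ) : excess c (r + c) = excess c r + r := by
  have h : (r + c) / c = r / c + 1 := by field_simp
  have h2 : (⌊r / c⌋ + Int.fract (r / c)) * c = r := by
    rw [Int.floor_add_fract]; field_simp
  rw [excess, excess, h, Int.floor_add_one, Int.fract_add_one]
  push_cast
  linear_combination h2

/-- The quadratic `r(r - c)/(2c)` solves the same recurrence as `excess`, so the two differ by a
periodic term, which lies between `0` and `c/8`. -/
theorem excess_eq {c : ℝ} (hc : 0 < c) (r : ℝ) : excess c r =
    r * (r - c) / (2 * c) + c * (Int.fract (r / c) * (1 - Int.fract (r / c))) / 2 := by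
  have h2 : r = (⌊r / c⌋ + Int.fract (r / c)) * c := by
    rw [Int.floor_add_fract]; field_simp
  rw [excess]
  generalize (⌊r / c⌋ : ℝ) = l at *
  generalize Int.fract (r / c) = f at *
  rw [h2]
  field_simp
  ring

theorem le_excess {c : ℝ} (hc : 0 < c) (r : ℝ) : r * (r - c) / (2 * c) ≤ excess c r := by
  have h1 := Int.fract_nonneg (r / c)
  have h2 := Int.fract_lt_one (r / c)
  rw [excess_eq hc]
  have : 0 ≤ c * (Int.fract (r / c) * (1 - Int.fract (r / c))) / 2 := by
    have : 0 ≤ 1 - Int.fract (r / c) := by linarith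
    positivity
  linarith

theorem excess_le {c : ℝ} (hc : 0 < c) (r : ℝ) : excess c r ≤ r * (r - c) / (2 * c) + c / 8 := by
  rw [excess_eq hc]
  have : Int.fract (r / c) * (1 - Int.fract (r / c)) ≤ 1 / 4 := by
    nlinarith [sq_nonneg (Int.fract (r / c) - 1 / 2)]
  nlinarith

theorem excess_nonneg {c : ℝ} (hc : 0 < c) (r : ℝ) : 0 ≤ excess c r := by
  have h1 := Int.fract_nonneg (r / c)
  have h2 := Int.fract_lt_one (r / c)
  rw [excess]
  apply mul_nonneg hc.le
  rcases le_or_gt 0 ⌊r / c⌋ with h | h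
  · have h3 : (0 : ℝ) ≤ ⌊r / c⌋ := by exact_mod_cast h
    have h4 : (0 : ℝ) ≤ ⌊r / c⌋ * (⌊r / c⌋ - 1) := by
      have : 0 ≤ ⌊r / c⌋ * (⌊r / c⌋ - 1) := by
        rcases h.eq_or_lt with h | h
        · simp [← h]
        · exact mul_nonneg h.le (by omega)
      exact_mod_cast this
    have := mul_nonneg h3 h1
    linarith
  · have h3 : (⌊r / c⌋ : ℝ) + 1 ≤ 0 := by exact_mod_cast h
    nlinarith

theorem excess_eq_zero {c : ℝ} (hc : 0 < c) {r : ℝ} (h0 : 0 ≤ r) (h1 : r ≤ c) :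
    excess c r = 0 := by
  rcases h1.eq_or_lt with rfl | h1
  · simp [excess, hc.ne']
  · have : ⌊r / c⌋ = 0 := Int.floor_eq_zero_iff.2 ⟨by positivity, (div_lt_one hc).2 h1⟩
    simp [excess, this]

/-- Every function on `ℤ` has a discrete antiderivative. -/
theorem exists_int_antideriv (g : ℤ → ℝ) : ∃ e : ℤ → ℝ, ∀ m, e (m + 1) = e m + g m := by
  refine ⟨fun m => match m with
    | Int.ofNat n => ∑ i ∈ Finset.range n, g i
    | Int.negSucc n => -∑ i ∈ Finset.range (n + 1), g (-(i + 1)), fun m => ?_⟩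
  match m with
  | Int.ofNat n => exact Finset.sum_range_succ _ _
  | Int.negSucc 0 => 
    change ∑ i ∈ Finset.range 0, g i = _
    simp
  | Int.negSucc (n + 1) =>
    change -∑ i ∈ Finset.range (n + 1), g (-(i + 1)) = _
    simp only [Finset.sum_range_succ _ (n + 1)]
    rw [show Int.negSucc (n + 1) = -(((n + 1 : ℕ) : ℤ) + 1) from rfl]
    ring

/-- The primitive of the barycenter form across `u`: along a path it varies by
`-½ ∫ (across)² d(along)`. -/
noncomputable def prim (u : ℝ × ℝ) (g : CartanReal) : ℝ :=
  baryAcross u g - along u g * across u g ^ 2 / 6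

/-- This is `-½∫₀¹ (a - s·u.2)² u.1 ds` with `a = across u g`: an east step advances by `u.1` along
`u` and by `-u.2` across. -/
theorem prim_mul_genX {u : ℝ × ℝ} (hu : u.1 ^ 2 + u.2 ^ 2 = 1) (g : CartanReal) : prim u (g * CartanReal.genX) =
    prim u g - u.1 / 2 * (across u g ^ 2 - across u g * u.2 + u.2 ^ 2 / 3) := by
  simp only [prim, baryAcross, along, across, CartanReal.genX, CartanReal.mul_x, CartanReal.mul_y,
    CartanReal.mul_baryX, CartanReal.mul_baryY, CartanReal.det]
  linear_combination (2 * (g.y * u.1 - g.x * u.2) - u.2) * g.y / 6 * hu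

theorem prim_mul_genY {u : ℝ × ℝ} (hu : u.1 ^ 2 + u.2 ^ 2 = 1) (g : CartanReal) : prim u (g * CartanReal.genY) =
    prim u g - u.2 / 2 * (across u g ^ 2 + across u g * u.1 + u.1 ^ 2 / 3) := by
  simp only [prim, baryAcross, along, across, CartanReal.genY, CartanReal.mul_x, CartanReal.mul_y,
    CartanReal.mul_baryX, CartanReal.mul_baryY, CartanReal.det]
  linear_combination -(2 * (g.y * u.1 - g.x * u.2) + u.1) * g.x / 6 * hu

/-- The coordinate along `u^⊥` of a lattice point. -/
noncomputable def level (u : ℝ × ℝ) (p : ℤ × ℤ) : ℝ := p.2 * u.1 - p.1 * u.2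

theorem height_eq_level (u : ℝ × ℝ) (p : ℤ × ℤ) :
    height u p = level u p + (u.1 - u.2) / 2 := by
  rw [height, level]; ring

/-- The loss of barycenter on a step, up to a coboundary. -/
noncomputable def slack (u : ℝ × ℝ) (p : ℤ × ℤ) : Step → ℝ
  | .east => excess u.1 (height u p)
  | .west => -excess u.1 (height u (p.1 - 1, p.2))
  | .north => 0
  | .south => 0

/-- The cubic term `u.2/(6 u.1)·level³` of `E` cancels the variation of `prim` on vertical steps.
What then remains on an east step is `excess` up to a function `G` of the level which has period
`u.1`, that is, which is invariant under vertical steps; so it can be summed along the columns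
alone. -/
theorem exists_potential {u : ℝ × ℝ} (hu : u.1 ^ 2 + u.2 ^ 2 = 1) (h1 : 0 < u.1) :
    ∃ E : ℤ × ℤ → ℝ, ∀ (s : Step) (p : ℤ × ℤ) (g : CartanReal), g.x = p.1 → g.y = p.2 →
      prim u (g * s.val) + slack u p s + E (s.move p) = prim u g + E p := by
  set G : ℝ → ℝ := fun t => u.1 / 2 * (t ^ 2 - t * u.2 + u.2 ^ 2 / 3) -
    excess u.1 (t + (u.1 - u.2) / 2) - u.2 / (6 * u.1) * ((t - u.2) ^ 3 - t ^ 3) with hG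
  -- The recurrence of `excess` is designed for this; the increments cancel because `u.1² + u.2² =
  -- 1`.
  have hper : Function.Periodic G u.1 := by
    intro t
    simp only [hG]
    rw [show t + u.1 + (u.1 - u.2) / 2 = t + (u.1 - u.2) / 2 + u.1 by ring, excess_add h1]
    field_simp
    linear_combination 18 * u.1 * (2 * t + u.1 - u.2) * hu
  obtain ⟨e, he⟩ := exists_int_antideriv fun m => G (-(m * u.2))
  have he' : ∀ p : ℤ × ℤ, e (p.1 + 1) = e p.1 + G (level u p) := by
    intro p
    have := hper.int_mul p.2 (-(p.1 * u.2))
    rw [he, ← this, level]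
    congr 2
    ring
  set E : ℤ × ℤ → ℝ := fun p => u.2 / (6 * u.1) * level u p ^ 3 + e p.1 with hE
  have east : ∀ (p : ℤ × ℤ) (g : CartanReal), g.x = p.1 → g.y = p.2 →
      prim u (g * CartanReal.genX) + excess u.1 (height u p) + E (p.1 + 1, p.2) =
        prim u g + E p := by
    intro p g hx hy
    have h3 : across u g = level u p := by rw [across, level, hx, hy]
    have h4 : level u (p.1 + 1, p.2) = level u p - u.2 := by simp only [level]; push_cast; ring
    simp only [hE]
    rw [prim_mul_genX hu, h3, he' p, h4, height_eq_level]
    simp only [hG]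
    ring
  have north : ∀ (p : ℤ × ℤ) (g : CartanReal), g.x = p.1 → g.y = p.2 →
      prim u (g * CartanReal.genY) + E (p.1, p.2 + 1) = prim u g + E p := by
    intro p g hx hy
    have h3 : across u g = level u p := by rw [across, level, hx, hy]
    have h4 : level u (p.1, p.2 + 1) = level u p + u.1 := by simp only [level]; push_cast; ring
    simp only [hE]
    rw [prim_mul_genY hu, h3, h4]
    field_simp
    ring
  refine ⟨E, fun s p g hx hy => ?_⟩
  cases s with
  | east => exact east p g hx hy
  | north => simpa [slack] using! north p g hx hy
  | west =>
    have := east (p.1 - 1, p.2) (g * CartanReal.genX⁻¹)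
      (by simp [hx, CartanReal.genX]; ring) (by simp [hy, CartanReal.genX])
    simp only [inv_mul_cancel_right, sub_add_cancel] at this
    simp only [slack, Step.move, Step.val]
    linarith
  | south =>
    have := north (p.1, p.2 - 1) (g * CartanReal.genY⁻¹)
      (by simp [hx, CartanReal.genY]) (by simp [hy, CartanReal.genY]; ring)
    simp only [inv_mul_cancel_right, sub_add_cancel] at this
    simp only [slack, Step.move, Step.val]
    linarith

/-- The total loss of barycenter along a word. -/
noncomputable def slackSum (u : ℝ × ℝ) : ℤ × ℤ → List Step → ℝ
  | _, [] => 0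
  | p, s :: l => slack u p s + slackSum u (s.move p) l

/-- The loss of barycenter on the steps to the east. -/
noncomputable def eastSum (u : ℝ × ℝ) : ℤ × ℤ → List Step → ℝ
  | _, [] => 0
  | p, .east :: l => excess u.1 (height u p) + eastSum u (Step.east.move p) l
  | p, s :: l => eastSum u (s.move p) l

/-- The number of steps to the west or to the south. -/
def backs : List Step → ℕ
  | [] => 0
  | .east :: l => backs l
  | .north :: l => backs l
  | _ :: l => backs l + 1

/-- All the vertices of the word are at distance at most `T` from the line `ℝu`. -/
def Within (u : ℝ × ℝ) (T : ℝ) : ℤ × ℤ → List Step → Prop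
  | p, [] => |level u p| ≤ T
  | p, s :: l => |level u p| ≤ T ∧ Within u T (s.move p) l

theorem Within.start {u : ℝ × ℝ} {T : ℝ} {p : ℤ × ℤ} {l : List Step} (h : Within u T p l) :
    |level u p| ≤ T := by
  cases l with
  | nil => exact h
  | cons s l => exact h.1

theorem Within.mono {u : ℝ × ℝ} {T T' : ℝ} (hT : T ≤ T') {p : ℤ × ℤ} {l : List Step}
    (h : Within u T p l) : Within u T' p l := by
  induction l generalizing p with
  | nil => exact h.trans hT
  | cons s l ih => exact ⟨h.1.trans hT, ih h.2⟩

/-- Cut the word at a vertex farthest from the line `ℝu`. -/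
theorem exists_extremal (u : ℝ × ℝ) (l : List Step) (p : ℤ × ℤ) :
    ∃ l₁ l₂, l = l₁ ++ l₂ ∧ Within u |level u (endpoint p l₁)| p l := by
  induction l generalizing p with
  | nil => exact ⟨[], [], rfl, le_rfl⟩
  | cons s l ih =>
    obtain ⟨l₁, l₂, rfl, h⟩ := ih (s.move p)
    rcases le_total |level u p| |level u (endpoint (s.move p) l₁)| with h' | h'
    · exact ⟨s :: l₁, l₂, rfl, h', h⟩
    · exact ⟨[], _, rfl, le_rfl, h.mono h'⟩

theorem Within.split {u : ℝ × ℝ} {T : ℝ} {p : ℤ × ℤ} {l₁ l₂ : List Step}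
    (h : Within u T p (l₁ ++ l₂)) : Within u T p l₁ ∧ Within u T (endpoint p l₁) l₂ := by
  induction l₁ generalizing p with
  | nil => exact ⟨h.start, h⟩
  | cons s l ih => exact ⟨⟨h.1, (ih h.2).1⟩, (ih h.2).2⟩

theorem endpoint_append (p : ℤ × ℤ) (l₁ l₂ : List Step) :
    endpoint p (l₁ ++ l₂) = endpoint (endpoint p l₁) l₂ := by
  induction l₁ generalizing p with
  | nil => rfl
  | cons s l ih => exact ih _

theorem eastSum_append (u : ℝ × ℝ) (p : ℤ × ℤ) (l₁ l₂ : List Step) :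
    eastSum u p (l₁ ++ l₂) = eastSum u p l₁ + eastSum u (endpoint p l₁) l₂ := by
  induction l₁ generalizing p with
  | nil => simp [eastSum, endpoint]
  | cons s l ih => cases s <;> simp [eastSum, endpoint, ih, add_assoc]

theorem backs_append (l₁ l₂ : List Step) : backs (l₁ ++ l₂) = backs l₁ + backs l₂ := by
  induction l₁ with
  | nil => simp [backs]
  | cons s l ih => cases s <;> simp [backs, ih] <;> ring

theorem eastSum_nonneg {u : ℝ × ℝ} (h1 : 0 < u.1) (p : ℤ × ℤ) (l : List Step) :
    0 ≤ eastSum u p l := by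
  induction l generalizing p with
  | nil => exact le_rfl
  | cons s l ih =>
    cases s
    · exact add_nonneg (excess_nonneg h1 _) (ih _)
    all_goals exact ih _

/-- Turns the extra length of a word into twice its number of backward steps. -/
theorem length_eq_backs (l : List Step) (p : ℤ × ℤ) :
    (l.length : ℤ) = (endpoint p l).1 + (endpoint p l).2 - (p.1 + p.2) + 2 * backs l := by
  induction l generalizing p with
  | nil => simp [endpoint, backs]
  | cons s l ih =>
    have := ih (s.move p)
    cases s <;> simp only [endpoint, backs, Step.move, List.length_cons] at this ⊢ <;>
      push_cast <;> omega

theorem prim_add_slackSum {u : ℝ × ℝ} {E : ℤ × ℤ → ℝ}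
    (hE : ∀ (s : Step) (p : ℤ × ℤ) (g : CartanReal), g.x = p.1 → g.y = p.2 →
      prim u (g * s.val) + slack u p s + E (s.move p) = prim u g + E p)
    (l : List Step) (p : ℤ × ℤ) (g : CartanReal) (hx : g.x = p.1) (hy : g.y = p.2) :
    prim u (g * (l.map Step.val).prod) + slackSum u p l + E (endpoint p l) = prim u g + E p ∧
      (g * (l.map Step.val).prod).x = (endpoint p l).1 ∧
      (g * (l.map Step.val).prod).y = (endpoint p l).2 := by
  induction l generalizing p g with
  | nil => simp [slackSum, endpoint, hx, hy]
  | cons s l ih =>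
    obtain ⟨mx, my⟩ := step_hat s p g hx hy
    obtain ⟨i1, i2, i3⟩ := ih (s.move p) (g * s.val) mx my
    have := hE s p g hx hy
    simp only [List.map_cons, List.prod_cons, ← mul_assoc, slackSum, endpoint]
    exact ⟨by linarith, i2, i3⟩

/-- The ray loses nothing: it moves east only at heights in `[0, u.1]`, where `excess` vanishes. -/
theorem prim_rayPath {u : ℝ × ℝ} (h1 : 0 < u.1) (h2 : 0 ≤ u.2) (τ : Bool) {E : ℤ × ℤ → ℝ}
    (hE : ∀ (s : Step) (p : ℤ × ℤ) (g : CartanReal), g.x = p.1 → g.y = p.2 →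
      prim u (g * s.val) + slack u p s + E (s.move p) = prim u g + E p) (n : ℕ) :
    prim u (rayPath u τ n).1 + E (rayHat u τ n) = prim u 1 + E (0, 0) := by
  induction n with
  | zero => rfl
  | succ n ih =>
    obtain ⟨h3, h4⟩ := rayPath_coords h1.le h2 τ n
    rcases rayHat_succ h1.le h2 τ n with ⟨h, h', h''⟩ | ⟨h, h', h''⟩
    · have := hE .east _ _ h3 h4
      simp only [slack, Step.val, Step.move,
        excess_eq_zero h1 h'' (rayHat_height h1.le h2 τ n).2] at this
      rw [h, h', ← ih, ← this, add_zero]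
      rfl
    · have := hE .north _ _ h3 h4
      simp only [slack, Step.val, Step.move] at this
      rw [h, h', ← ih, ← this, add_zero]
      rfl

/-- A monotone function growing cubically, constant near `0`. -/
noncomputable def cubic (t : ℝ) : ℝ := max (t - 2) 0 ^ 3 - max (-t - 2) 0 ^ 3

theorem cubic_mono : Monotone cubic := by
  intro s t h
  have h1 : max (s - 2) 0 ^ 3 ≤ max (t - 2) 0 ^ 3 := by gcongr
  have h2 : max (-t - 2) 0 ^ 3 ≤ max (-s - 2) 0 ^ 3 := by gcongr
  simp only [cubic]
  linarith

theorem cube_sub_cube_le {a b : ℝ} (hb : 0 ≤ b) (hab : b ≤ a) (h : a - b ≤ 1) :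
    a ^ 3 - b ^ 3 ≤ 3 * a ^ 2 := by
  have h1 : a ^ 2 + a * b + b ^ 2 ≤ 3 * a ^ 2 := by nlinarith
  have ha : 0 ≤ a := hb.trans hab
  have h2 : 0 ≤ a ^ 2 + a * b + b ^ 2 := by positivity
  nlinarith

theorem cubic_sub_le (t : ℝ) {d : ℝ} (h0 : 0 ≤ d) (h1 : d ≤ 1) :
    cubic t - cubic (t - d) ≤ 3 * max (t - 2) 0 ^ 2 + 3 * max (d - t - 2) 0 ^ 2 := by
  have a1 : max (t - 2) 0 - max (t - d - 2) 0 ≤ 1 := by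
    have := le_max_left (t - d - 2) 0
    have := le_max_right (t - d - 2) 0
    rcases max_cases (t - 2) 0 with ⟨h, _⟩ | ⟨h, _⟩ <;> rw [h] <;> linarith
  have a2 : max (d - t - 2) 0 - max (-t - 2) 0 ≤ 1 := by
    have := le_max_left (-t - 2) 0
    have := le_max_right (-t - 2) 0
    rcases max_cases (d - t - 2) 0 with ⟨h, _⟩ | ⟨h, _⟩ <;> rw [h] <;> linarith
  have b1 := cube_sub_cube_le (le_max_right (t - d - 2) 0)
    (max_le_max_right 0 (by linarith : t - d - 2 ≤ t - 2)) a1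
  have b2 := cube_sub_cube_le (le_max_right (-t - 2) 0)
    (max_le_max_right 0 (by linarith : -t - 2 ≤ d - t - 2)) a2
  simp only [cubic]
  rw [show -(t - d) - 2 = d - t - 2 by ring]
  linarith

/-- The drop of `cubic` on an east step is paid by the loss on that step: both grow quadratically in
`t`, and the flat part of `cubic` covers the levels where `excess` may vanish. -/
theorem cubic_sub_le_excess {u : ℝ × ℝ} (h1 : 0 < u.1) (h1' : u.1 ≤ 1) (h2 : 0 ≤ u.2)
    (h3 : u.2 ≤ u.1) (t : ℝ) :
    cubic t - cubic (t - u.2) ≤ 6 * excess u.1 (t + (u.1 - u.2) / 2) := by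
  have hb := cubic_sub_le t h2 (h3.trans h1')
  have hn := excess_nonneg h1 (t + (u.1 - u.2) / 2)
  have key : ∀ r : ℝ, 0 ≤ r * (r - u.1) → r * (r - u.1) / 2 ≤ excess u.1 r := by
    intro r hr
    refine le_trans ?_ (le_excess h1 r)
    gcongr
    linarith
  rcases le_or_gt t 2 with ht | ht
  · rw [max_eq_right (by linarith : t - 2 ≤ 0)] at hb
    rcases le_or_gt (u.2 - t - 2) 0 with ht' | ht'
    · rw [max_eq_right ht'] at hb
      linarith
    · rw [max_eq_left ht'.le] at hb
      have := key (t + (u.1 - u.2) / 2) (by nlinarith)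
      nlinarith
  · rw [max_eq_left (by linarith : 0 ≤ t - 2), max_eq_right (by linarith : u.2 - t - 2 ≤ 0)] at hb
    have := key (t + (u.1 - u.2) / 2) (by nlinarith)
    nlinarith

theorem level_west (u : ℝ × ℝ) (p : ℤ × ℤ) : level u (p.1 - 1, p.2) = level u p + u.2 := by
  simp only [level]; push_cast; ring

theorem level_east (u : ℝ × ℝ) (p : ℤ × ℤ) : level u (p.1 + 1, p.2) = level u p - u.2 := by
  simp only [level]; push_cast; ring

theorem level_north (u : ℝ × ℝ) (p : ℤ × ℤ) : level u (p.1, p.2 + 1) = level u p + u.1 := by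
  simp only [level]; push_cast; ring

theorem level_south (u : ℝ × ℝ) (p : ℤ × ℤ) : level u (p.1, p.2 - 1) = level u p - u.1 := by
  simp only [level]; push_cast; ring

/-- Only west steps can gain, each by a value of `excess` taken within distance `T` of the line,
hence by at most `(T+2)²`. -/
theorem neg_slackSum_le {u : ℝ × ℝ} (h1 : 1 / 2 ≤ u.1) (h1' : u.1 ≤ 1) (h2 : 0 ≤ u.2)
    (h3 : u.2 ≤ u.1) {T : ℝ} {p : ℤ × ℤ} {l : List Step} (h : Within u T p l) :
    -slackSum u p l ≤ backs l * (T + 2) ^ 2 - eastSum u p l := by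
  induction l generalizing p with
  | nil => simp [slackSum, backs, eastSum]
  | cons s l ih =>
    have := ih h.2
    cases s with
    | east => simp only [slackSum, slack, eastSum, backs] at this ⊢; linarith
    | north => simp only [slackSum, slack, eastSum, backs] at this ⊢; linarith
    | south =>
      simp only [slackSum, slack, eastSum, backs] at this ⊢
      push_cast
      nlinarith [sq_nonneg (T + 2)]
    | west =>
      have hT := abs_le.1 h.2.start
      simp only [slackSum, slack, eastSum, backs, Step.move] at this hT ⊢
      have h4 : excess u.1 (height u (p.1 - 1, p.2)) ≤ (T + 2) ^ 2 := by
        rw [height_eq_level]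
        generalize level u (p.1 - 1, p.2) = t at hT
        have hr1 : -(T + 1 / 2) ≤ t + (u.1 - u.2) / 2 := by linarith
        have hr2 : t + (u.1 - u.2) / 2 ≤ T + 1 / 2 := by linarith
        generalize t + (u.1 - u.2) / 2 = r at hr1 hr2
        refine (excess_le (by linarith) r).trans ?_
        have h5 : r * (r - u.1) / (2 * u.1) = r ^ 2 / (2 * u.1) - r / 2 := by
          field_simp
        have h6 : r ^ 2 / (2 * u.1) ≤ r ^ 2 := by
          apply div_le_self (sq_nonneg r); linarith
        rw [h5]
        nlinarith
      push_cast
      linarith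

/-- The level can go down only on east steps, charged to `excess`, and on south steps, charged to
`backs`. -/
theorem cubic_sub_le_eastSum {u : ℝ × ℝ} (h1 : 0 < u.1) (h1' : u.1 ≤ 1) (h2 : 0 ≤ u.2)
    (h3 : u.2 ≤ u.1) {T : ℝ} {p : ℤ × ℤ} {l : List Step} (h : Within u T p l) :
    cubic (level u p) - cubic (level u (endpoint p l)) ≤
      6 * eastSum u p l + 3 * backs l * (T + 2) ^ 2 := by
  induction l generalizing p with
  | nil => simp [endpoint, eastSum, backs]
  | cons s l ih =>
    have := ih h.2
    have hT := abs_le.1 h.1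
    cases s with
    | east =>
      have h4 := cubic_sub_le_excess h1 h1' h2 h3 (level u p)
      simp only [eastSum, backs, Step.move, endpoint, level_east, height_eq_level] at this ⊢
      linarith
    | north =>
      have h4 := cubic_mono (by linarith : level u p ≤ level u p + u.1)
      simp only [eastSum, backs, Step.move, endpoint, level_north] at this ⊢
      linarith
    | west =>
      have h4 := cubic_mono (by linarith : level u p ≤ level u p + u.2)
      simp only [eastSum, backs, Step.move, endpoint, level_west] at this ⊢
      push_cast
      nlinarith [sq_nonneg (T + 2)]
    | south =>
      have h4 := cubic_sub_le (level u p) h1.le h1'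
      simp only [eastSum, backs, Step.move, endpoint, level_south] at this ⊢
      have h5 : 3 * max (level u p - 2) 0 ^ 2 + 3 * max (u.1 - level u p - 2) 0 ^ 2 ≤
          3 * (T + 2) ^ 2 := by
        rcases max_cases (level u p - 2) 0 with ⟨h, h'⟩ | ⟨h, h'⟩ <;> rw [h] <;>
        rcases max_cases (u.1 - level u p - 2) 0 with ⟨h, h''⟩ | ⟨h, h''⟩ <;> rw [h] <;> nlinarith
      push_cast
      linarith

/-- With `k` backward steps and maximal distance `T`, the gain is at most of order `kT²`, while an
excursion to distance `T` loses order `T³` unless `T = O(k)`. -/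
theorem neg_slackSum_le_cube {u : ℝ × ℝ} (h1 : 1 / 2 ≤ u.1) (h1' : u.1 ≤ 1) (h2 : 0 ≤ u.2)
    (h3 : u.2 ≤ u.1) (l : List Step) (hl : |level u (endpoint (0, 0) l)| ≤ 2) :
    -slackSum u (0, 0) l ≤ 2904 * (backs l : ℝ) ^ 3 := by
  have h0 : 0 < u.1 := by linarith
  obtain ⟨l₁, l₂, rfl, h⟩ := exists_extremal u l (0, 0)
  set T := |level u (endpoint (0, 0) l₁)| with hT
  have hT0 : 0 ≤ T := abs_nonneg _
  have a := neg_slackSum_le h1 h1' h2 h3 h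
  have b1 := cubic_sub_le_eastSum h0 h1' h2 h3 h.split.1
  have b2 := cubic_sub_le_eastSum h0 h1' h2 h3 h.split.2
  have r1 := eastSum_nonneg h0 (0, 0) l₁
  have r2 := eastSum_nonneg h0 (endpoint (0, 0) l₁) l₂
  rw [← endpoint_append] at b2
  rw [eastSum_append] at a
  have hk : (backs (l₁ ++ l₂) : ℝ) = backs l₁ + backs l₂ := by rw [backs_append]; push_cast; ring
  have k1 : (0 : ℝ) ≤ backs l₁ := by positivity
  have k2 : (0 : ℝ) ≤ backs l₂ := by positivity
  have c0 : ∀ t : ℝ, |t| ≤ 2 → cubic t = 0 := by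
    intro t ht
    have := abs_le.1 ht
    rw [cubic, max_eq_right (by linarith), max_eq_right (by linarith)]
    ring
  rw [c0 _ hl] at b2
  rw [c0 (level u (0, 0)) (by simp [level])] at b1
  have q1 : 0 ≤ backs l₁ * (T + 2) ^ 2 := by positivity
  have q2 : 0 ≤ backs l₂ * (T + 2) ^ 2 := by positivity
  -- Descending is the costly direction: if the farthest vertex is above the line, the way back
  -- pays; if it is below, the way out pays. Both ends of the word have level in `[-2, 2]`, where
  -- `cubic` vanishes.
  have main : max (T - 2) 0 ^ 3 ≤ 6 * (eastSum u (0, 0) l₁ + eastSum u (endpoint (0, 0) l₁) l₂) +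
      3 * (backs l₁ + backs l₂) * (T + 2) ^ 2 := by
    rcases le_total 0 (level u (endpoint (0, 0) l₁)) with hs | hs
    · rw [abs_of_nonneg hs] at hT
      rw [← hT, cubic, max_eq_right (by linarith : -T - 2 ≤ 0)] at b2
      linarith
    · rw [abs_of_nonpos hs] at hT
      rw [show level u (endpoint (0, 0) l₁) = -T by linarith, cubic,
        max_eq_right (by linarith : -T - 2 ≤ 0), neg_neg] at b1
      linarith
  rw [← hk] at main
  have hk0 : backs (l₁ ++ l₂) = 0 ∨ 1 ≤ backs (l₁ ++ l₂) := by omega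
  generalize hkk : backs (l₁ ++ l₂) = n at *
  rcases hk0 with rfl | hk1
  · push_cast at a ⊢
    linarith
  · have hn : (1 : ℝ) ≤ n := by exact_mod_cast hk1
    generalize (n : ℝ) = k at *
    have bound : -slackSum u (0, 0) (l₁ ++ l₂) ≤
        3 / 2 * (k * (T + 2) ^ 2) - max (T - 2) 0 ^ 3 / 6 := by linarith
    refine bound.trans ?_
    -- For `T ≤ 36k + 6` and `k ≥ 1` one has `T + 2 ≤ 44k`, and `3/2 · 44² = 2904`. Beyond it `T + 2
    -- ≤ 2(T - 2)`, and the cubic loss exceeds the quadratic gain.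
    rcases le_or_gt T (36 * k + 6) with hle | hgt
    · have : (T + 2) ^ 2 ≤ (44 * k) ^ 2 := by gcongr; linarith
      have h5 : k * (T + 2) ^ 2 ≤ k * (44 * k) ^ 2 := by gcongr
      have h6 : 0 ≤ max (T - 2) 0 ^ 3 := by positivity
      nlinarith
    · rw [max_eq_left (by linarith)]
      have h4 : (T + 2) ^ 2 ≤ (2 * (T - 2)) ^ 2 := by gcongr; linarith
      have h5 : k * (T + 2) ^ 2 ≤ k * (2 * (T - 2)) ^ 2 := by gcongr
      have h6 : 36 * k * (T - 2) ^ 2 ≤ (T - 2) * (T - 2) ^ 2 := by gcongr; linarith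
      have h7 : 0 ≤ k ^ 3 := by positivity
      nlinarith

/-- The barycenter of a loop is controlled by the excess length of the ray translated by it. -/
theorem baryAcross_inv_le {u : ℝ × ℝ} (hu : u.1 ^ 2 + u.2 ^ 2 = 1) (h2 : 0 ≤ u.2)
    (h3 : u.2 ≤ u.1) (τ : Bool) {h : Cartan} (hh : h.1.IsLoop) (n : ℕ) :
    -baryAcross u h.1 ≤ 2904 * ((norm (h⁻¹ * rayPath u τ n) : ℝ) - n) ^ 3 := by
  have h1 : 1 / 2 ≤ u.1 := by nlinarith
  have h1' : u.1 ≤ 1 := by nlinarith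
  have h0 : 0 < u.1 := by linarith
  obtain ⟨E, hE⟩ := exists_potential hu h0
  obtain ⟨l, hl, hp⟩ := exists_steps (h⁻¹ * rayPath u τ n)
  obtain ⟨a1, a2, a3⟩ := prim_add_slackSum hE l (0, 0) 1 (by simp) (by simp)
  have b := prim_rayPath h0 h2 τ hE n
  obtain ⟨x1, y1⟩ := rayPath_coords h0.le h2 τ n
  have hm : (h⁻¹ * rayPath u τ n).1 = h.1⁻¹ * (rayPath u τ n).1 := rfl
  obtain ⟨m1, m2, -, m3, m4⟩ := CartanReal.loop_mul hh.inv (rayPath u τ n).1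
  rw [← hm] at m1 m2 m3 m4
  rw [one_mul, hp] at a1 a2 a3
  have hend : endpoint (0, 0) l = rayHat u τ n := by
    ext
    · exact_mod_cast (a2.symm.trans (m1.trans x1))
    · exact_mod_cast (a3.symm.trans (m2.trans y1))
  have hlev : |level u (endpoint (0, 0) l)| ≤ 2 := by
    have := rayHat_height h0.le h2 τ n
    rw [height_eq_level] at this
    rw [hend, abs_le]
    constructor <;> linarith
  have key := neg_slackSum_le_cube h1 h1' h2 h3 l hlev
  have hlen := length_eq_backs l (0, 0)
  have hsum := rayHat_sum h0.le h2 τ n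
  rw [hend] at hlen a1
  have hk : (norm (h⁻¹ * rayPath u τ n) : ℝ) - n = 2 * backs l := by
    have : (norm (h⁻¹ * rayPath u τ n) : ℤ) = n + 2 * backs l := by rw [← hl]; simp at hlen; omega
    have : (norm (h⁻¹ * rayPath u τ n) : ℝ) = n + 2 * backs l := by exact_mod_cast this
    linarith
  obtain ⟨-, i1, i2⟩ := CartanReal.inv_eq_of_isLoop hh
  -- The two words have the same endpoint, so `E` cancels between `a1` and `b`, and `slackSum`
  -- equals `baryAcross u h.1`.
  have hprim : prim u (h⁻¹ * rayPath u τ n).1 = prim u (rayPath u τ n).1 - baryAcross u h.1 := by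
    simp only [prim, along, across, baryAcross, m1, m2, m3, m4, i1, i2]
    ring
  rw [hk]
  have : 0 ≤ (backs l : ℝ) ^ 3 := by positivity
  nlinarith

/-! ### Modifications of the ray -/

/-- The loop `f` can be realized by replacing the part of the ray between the times `i` and `j` by a
path with at most `k` more steps. -/
def Move (u : ℝ × ℝ) (τ : Bool) (k i j : ℕ) (f : Cartan) : Prop :=
  f.1.IsLoop ∧ i ≤ j ∧ norm ((rayPath u τ i)⁻¹ * f * rayPath u τ j) + i ≤ j + k

theorem Move.mul {u : ℝ × ℝ} {τ : Bool} {k k' i j l : ℕ} {f g : Cartan} (hf : Move u τ k i j f)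
    (hg : Move u τ k' j l g) : Move u τ (k + k') i l (f * g) := by
  obtain ⟨f1, f2, f3⟩ := hf
  obtain ⟨g1, g2, g3⟩ := hg
  refine ⟨f1.mul g1, f2.trans g2, ?_⟩
  have := norm_mul_le ((rayPath u τ i)⁻¹ * f * rayPath u τ j) ((rayPath u τ j)⁻¹ * g * rayPath u τ l)
  rw [show (rayPath u τ i)⁻¹ * f * rayPath u τ j * ((rayPath u τ j)⁻¹ * g * rayPath u τ l) =
    (rayPath u τ i)⁻¹ * (f * g) * rayPath u τ l by group] at this
  omega

theorem Move.one (u : ℝ × ℝ) (τ : Bool) {i j : ℕ} (h1 : 0 ≤ u.1) (h2 : 0 ≤ u.2) (hij : i ≤ j) :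
    Move u τ 0 i j 1 := by
  refine ⟨⟨rfl, rfl⟩, hij, ?_⟩
  have := norm_rayPath_between h1 h2 τ i (j - i)
  rw [Nat.add_sub_cancel' hij] at this
  rw [mul_one]
  omega

theorem Move.extend_left {u : ℝ × ℝ} {τ : Bool} {k i i' j : ℕ} {f : Cartan} (h1 : 0 ≤ u.1)
    (h2 : 0 ≤ u.2) (hi : i' ≤ i) (hf : Move u τ k i j f) : Move u τ k i' j f := by
  simpa using (Move.one u τ h1 h2 hi).mul hf

theorem area_mul_of_isLoop {f : Cartan} (hf : f.1.IsLoop) (g : Cartan) :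
    (f * g).1.area = f.1.area + g.1.area :=
  (CartanReal.loop_mul hf g.1).2.2.1

theorem baryAcross_mul_of_isLoop (u : ℝ × ℝ) {f : Cartan} (hf : f.1.IsLoop) (g : Cartan) :
    baryAcross u (f * g).1 = baryAcross u f.1 + baryAcross u g.1 := by
  obtain ⟨-, -, -, h1, h2⟩ := CartanReal.loop_mul hf g.1
  have h : (f * g).1 = f.1 * g.1 := rfl
  simp only [baryAcross, h, h1, h2]
  ring

theorem baryAlong_mul_of_isLoop (u : ℝ × ℝ) {f : Cartan} (hf : f.1.IsLoop) (g : Cartan) :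
    baryAlong u (f * g).1 = baryAlong u f.1 + baryAlong u g.1 := by
  obtain ⟨-, -, -, h1, h2⟩ := CartanReal.loop_mul hf g.1
  have h : (f * g).1 = f.1 * g.1 := rfl
  simp only [baryAlong, h, h1, h2]
  ring

theorem inv_of_isLoop (u : ℝ × ℝ) {f : Cartan} (hf : f.1.IsLoop) :
    (f⁻¹).1.IsLoop ∧ (f⁻¹).1.area = -f.1.area ∧ baryAcross u (f⁻¹).1 = -baryAcross u f.1 ∧
      baryAlong u (f⁻¹).1 = -baryAlong u f.1 := by
  obtain ⟨h1, h2, h3⟩ := CartanReal.inv_eq_of_isLoop hf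
  have h : (f⁻¹).1 = f.1⁻¹ := rfl
  simp only [baryAlong, baryAcross, h, h1, h2, h3]
  exact ⟨hf.inv, trivial, by ring, by ring⟩

theorem conj_of_isLoop (u : ℝ × ℝ) {c : Cartan} (hc : c.1.IsLoop) (g : Cartan) :
    (g * c * g⁻¹).1.IsLoop ∧ (g * c * g⁻¹).1.area = c.1.area ∧
      baryAcross u (g * c * g⁻¹).1 = baryAcross u c.1 + across u g.1 * c.1.area ∧
      baryAlong u (g * c * g⁻¹).1 = baryAlong u c.1 + along u g.1 * c.1.area := by
  obtain ⟨h1, h2, h3, h4⟩ := CartanReal.IsLoop.conj hc g.1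
  have h : (g * c * g⁻¹).1 = g.1 * c.1 * g.1⁻¹ := rfl
  simp only [baryAlong, baryAcross, along, across, h, h2, h3, h4]
  exact ⟨h1, trivial, by ring, by ring⟩

/-- The difference between the ray and the path following `v` before and `v⁻¹` after the part of the
ray between the times `i` and `j`. -/
noncomputable def twist (u : ℝ × ℝ) (τ : Bool) (v : Cartan) (i j : ℕ) : Cartan :=
  rayPath u τ i * v * (rayPath u τ i)⁻¹ * (rayPath u τ j * v * (rayPath u τ j)⁻¹)⁻¹

theorem twist_mul (u : ℝ × ℝ) (τ : Bool) (v : Cartan) (i j l : ℕ) :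
    twist u τ v i j * twist u τ v j l = twist u τ v i l := by
  simp only [twist]; group

theorem twist_self (u : ℝ × ℝ) (τ : Bool) (v : Cartan) (i : ℕ) : twist u τ v i i = 1 := by
  simp [twist]

theorem isLoop_twist (u : ℝ × ℝ) (τ : Bool) (v : Cartan) (i j : ℕ) :
    (twist u τ v i j).1.IsLoop := by
  simp [twist, CartanReal.IsLoop]

/-- The cost does not depend on the length `j - i` of the shifted portion; this is the source of all
corrections of bounded cost. -/
theorem move_twist {u : ℝ × ℝ} (h1 : 0 ≤ u.1) (h2 : 0 ≤ u.2) (τ : Bool) (v : Cartan) {i j : ℕ}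
    (hij : i ≤ j) : Move u τ (2 * norm v) i j (twist u τ v i j) := by
  refine ⟨isLoop_twist u τ v i j, hij, ?_⟩
  have a := norm_rayPath_between h1 h2 τ i (j - i)
  rw [Nat.add_sub_cancel' hij] at a
  have b := norm_mul_le (v * ((rayPath u τ i)⁻¹ * rayPath u τ j)) v⁻¹
  have c := norm_mul_le v ((rayPath u τ i)⁻¹ * rayPath u τ j)
  rw [norm_inv, show v * ((rayPath u τ i)⁻¹ * rayPath u τ j) * v⁻¹ =
    (rayPath u τ i)⁻¹ * twist u τ v i j * rayPath u τ j by simp only [twist]; group] at b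
  omega

theorem abs_across_le {u : ℝ × ℝ} (h1 : 0 ≤ u.1) (h2 : 0 ≤ u.2) (h1' : u.1 ≤ 1) (h2' : u.2 ≤ 1)
    (τ : Bool) (n : ℕ) : |across u (rayPath u τ n).1| ≤ 1 := by
  have := rayHat_height h1 h2 τ n
  rw [across_eq_height h1 h2, abs_le]
  constructor <;> linarith

/-- The ray moves to the east at least once in every three steps. -/
theorem exists_fst_succ {u : ℝ × ℝ} (h1 : 0 < u.1) (h2 : 0 ≤ u.2) (h3 : u.2 ≤ u.1) (τ : Bool)
    (i : ℕ) : ∃ j, i ≤ j ∧ (rayHat u τ j).1 = (rayHat u τ i).1 + 1 := by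
  rcases rayHat_succ h1.le h2 τ i with ⟨a, -⟩ | ⟨a, -⟩
  · exact ⟨i + 1, by omega, by rw [a]⟩
  rcases rayHat_succ h1.le h2 τ (i + 1) with ⟨b, -⟩ | ⟨b, -⟩
  · exact ⟨i + 1 + 1, by omega, by rw [b, a]⟩
  rcases rayHat_succ h1.le h2 τ (i + 1 + 1) with ⟨c, -⟩ | ⟨c, -⟩
  · exact ⟨i + 1 + 1 + 1, by omega, by rw [c, b, a]⟩
  exfalso
  have h4 := rayHat_height h1.le h2 τ i
  have h5 := rayHat_height h1.le h2 τ (i + 1 + 1 + 1)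
  rw [c, b, a] at h5
  simp only [height] at h4 h5
  push_cast at h5
  linarith

theorem exists_column_seq {u : ℝ × ℝ} (h1 : 0 < u.1) (h2 : 0 ≤ u.2) (h3 : u.2 ≤ u.1) (τ : Bool)
    (i : ℕ) : ∃ e : ℕ → ℕ, e 0 = i ∧ Monotone e ∧
      ∀ D, (rayHat u τ (e D)).1 = (rayHat u τ i).1 + D := by
  choose nx h4 h5 using exists_fst_succ h1 h2 h3 τ
  refine ⟨fun D => nx^[D] i, rfl, monotone_nat_of_le_succ fun D => ?_, fun D => ?_⟩
  · simp only [Function.iterate_succ_apply']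
    exact h4 _
  · induction D with
    | zero => simp
    | succ D ih =>
      simp only [Function.iterate_succ_apply'] at ih ⊢
      rw [h5, ih]
      push_cast
      ring

/-- A discrete intermediate value argument: stop at the first time when `f` is at most `-N`. -/
theorem exists_abs_add_le {f : ℕ → ℝ} {c : ℝ} (h0 : f 0 = 0) (hc : ∀ n, |f (n + 1) - f n| ≤ c)
    (hf : ∀ N : ℝ, ∃ n, f n ≤ -N) {N : ℝ} (hN : 0 ≤ N) : ∃ n, |f n + N| ≤ c := by
  classical
  have hex := hf N
  refine ⟨Nat.find hex, ?_⟩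
  have h1 := Nat.find_spec hex
  rcases hn : Nat.find hex with _ | m
  · rw [hn, h0] at h1
    rw [h0, show (0 : ℝ) + N = 0 by linarith, abs_zero]
    exact (abs_nonneg _).trans (hc 0)
  · rw [hn] at h1
    have h2 := Nat.find_min hex (m := m) (by omega)
    have h3 := abs_le.1 (hc m)
    rw [abs_le]
    constructor <;> linarith

/-- Displacing a unit square along the ray changes the barycenter along `u`. -/
theorem exists_move_along {u : ℝ × ℝ} (hu : u.1 ^ 2 + u.2 ^ 2 = 1) (h2 : 0 ≤ u.2) (h3 : u.2 ≤ u.1)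
    (τ : Bool) (i : ℕ) (q : ℝ) : ∃ j f, Move u τ 8 i j f ∧ f.1.area = 0 ∧
      |baryAcross u f.1| ≤ 2 ∧ |baryAlong u f.1 - q| ≤ 1 := by
  have h1 : 1 / 2 ≤ u.1 := by nlinarith
  have h1' : u.1 ≤ 1 := by nlinarith
  have h0 : 0 < u.1 := by linarith
  -- A loop placed at `γ_i` and its inverse at `γ_j`: the areas cancel, and the barycenter records
  -- the displacement, which is bounded across `u` since the ray stays near the line.
  have tw : ∀ (c : Cartan) (j : ℕ), c.1.IsLoop → norm c ≤ 4 → i ≤ j →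
      Move u τ 8 i j (twist u τ c i j) ∧ (twist u τ c i j).1.area = 0 ∧
      baryAcross u (twist u τ c i j).1 =
        (across u (rayPath u τ i).1 - across u (rayPath u τ j).1) * c.1.area ∧
      baryAlong u (twist u τ c i j).1 =
        (along u (rayPath u τ i).1 - along u (rayPath u τ j).1) * c.1.area := by
    intro c j hc hn hij
    obtain ⟨a1, a2, a3, a4⟩ := conj_of_isLoop u hc (rayPath u τ i)
    obtain ⟨b1, b2, b3, b4⟩ := conj_of_isLoop u hc (rayPath u τ j)
    obtain ⟨c1, c2, c3, c4⟩ := inv_of_isLoop u b1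
    obtain ⟨m1, m2, m3⟩ := move_twist h0.le h2 τ c hij
    refine ⟨⟨m1, m2, by omega⟩, ?_, ?_, ?_⟩
    · rw [twist, area_mul_of_isLoop a1, a2, c2, b2]; ring
    · rw [twist, baryAcross_mul_of_isLoop u a1, a3, c3, b3]; ring
    · rw [twist, baryAlong_mul_of_isLoop u a1, a4, c4, b4]; ring
  have hdist : ∀ N : ℝ, 0 ≤ N → ∃ j, i ≤ j ∧
      |along u (rayPath u τ i).1 - along u (rayPath u τ j).1 + N| ≤ 1 := by
    intro N hN
    have hval : ∀ n, along u (rayPath u τ n).1 =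
        (rayHat u τ n).1 * u.1 + (rayHat u τ n).2 * u.2 := by
      intro n
      rw [along, (rayPath_coords h0.le h2 τ n).1, (rayPath_coords h0.le h2 τ n).2]
    obtain ⟨n, hn⟩ := exists_abs_add_le (c := 1)
      (f := fun n => along u (rayPath u τ i).1 - along u (rayPath u τ (i + n)).1) (by simp) (by
        intro n
        simp only [hval, ← add_assoc]
        rcases rayHat_succ h0.le h2 τ (i + n) with ⟨h, -⟩ | ⟨h, -⟩ <;> rw [h] <;> push_cast <;>
          rw [abs_le] <;> constructor <;> linarith) (by
        intro N
        obtain ⟨e, he0, hem, he⟩ := exists_column_seq h0 h2 h3 τ i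
        obtain ⟨D, hD⟩ := exists_nat_ge (2 * N)
        have hi : i ≤ e D := he0 ▸ hem (Nat.zero_le D)
        refine ⟨e D - i, ?_⟩
        simp only [hval, Nat.add_sub_cancel' hi]
        have hy : (rayHat u τ i).2 ≤ (rayHat u τ (e D)).2 :=
          (monotone_nat_of_le_succ (f := fun n => (rayHat u τ n).2) fun n => by
            rcases rayHat_succ h0.le h2 τ n with ⟨h, _⟩ | ⟨h, _⟩ <;> simp [h]) hi
        have hy' : ((rayHat u τ i).2 : ℝ) ≤ (rayHat u τ (e D)).2 := by exact_mod_cast hy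
        rw [he D]
        push_cast
        have hD0 : (0 : ℝ) ≤ D := by positivity
        nlinarith) hN
    exact ⟨i + n, by omega, hn⟩
  have hcomm : ∃ c : Cartan, c.1.IsLoop ∧ norm c ≤ 4 ∧ c.1.area = 1 := by
    refine ⟨X * Y * X⁻¹ * Y⁻¹, ?_, ?_, ?_⟩
    · simp [CartanReal.IsLoop]
    · have a := norm_mul_le (X * Y * X⁻¹) Y⁻¹
      have b := norm_mul_le (X * Y) X⁻¹
      have c := norm_mul_le X Y
      have := norm_X_le
      have := norm_Y_le
      rw [norm_inv] at a b
      omega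
    · simp [CartanReal.mul_area, CartanReal.det, coe_X, coe_Y, CartanReal.genX, CartanReal.genY]
      norm_num
  obtain ⟨c, c1, c2, c3⟩ := hcomm
  obtain ⟨d1, d2, -⟩ := inv_of_isLoop u c1
  have hac := fun n => abs_le.1 (abs_across_le h0.le h2 h1' (h3.trans h1') τ n)
  rcases le_total 0 q with hq | hq
  · obtain ⟨j, hij, hj⟩ := hdist q hq
    obtain ⟨t1, t2, t3, t4⟩ := tw c⁻¹ j d1 (by rwa [norm_inv]) hij
    refine ⟨j, _, t1, t2, ?_, ?_⟩
    · rw [t3, d2, c3, abs_le]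
      constructor <;> linarith [hac i, hac j]
    · rw [t4, d2, c3, abs_sub_comm]
      convert hj using 2
      ring
  · obtain ⟨j, hij, hj⟩ := hdist (-q) (by linarith)
    obtain ⟨t1, t2, t3, t4⟩ := tw c j c1 c2 hij
    refine ⟨j, _, t1, t2, ?_, ?_⟩
    · rw [t3, c3, abs_le]
      constructor <;> linarith [hac i, hac j]
    · rw [t4, c3]
      convert hj using 2
      ring

/-- Area and barycenter across `u` of a shift by `q` units to the north. -/
theorem twist_north {u : ℝ × ℝ} (h1 : 0 ≤ u.1) (h2 : 0 ≤ u.2) (h1' : u.1 ≤ 1) (h2' : u.2 ≤ 1)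
    (τ : Bool) (q : ℤ) {i j : ℕ} (hij : i ≤ j) :
    (twist u τ (Y ^ q) i j).1.area = -q * ((rayHat u τ j).1 - (rayHat u τ i).1) ∧
    |baryAcross u (twist u τ (Y ^ q) i j).1 + q ^ 2 * u.1 / 2 *
        ((rayHat u τ j).1 - (rayHat u τ i).1)| ≤
      2 * |(q : ℝ)| * ((rayHat u τ j).1 - (rayHat u τ i).1) := by
  induction j, hij using Nat.le_induction with
  | base => simp [twist_self, baryAcross]
  | succ j hij ih =>
    rw [← twist_mul u τ _ i j, area_mul_of_isLoop (isLoop_twist _ _ _ _ _),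
      baryAcross_mul_of_isLoop u (isLoop_twist _ _ _ _ _)]
    -- An east step adds to the strip a column of `|q|` squares, whose center is about `q·u.1/2`
    -- from the line; a north step commutes with `Y ^ q` and adds nothing. The contribution to the
    -- barycenter is even in `q` to leading order.
    rcases rayHat_succ h1 h2 τ j with ⟨h, h', -⟩ | ⟨h, h', -⟩
    · have hc : (Y ^ q * X * (Y ^ q)⁻¹ * X⁻¹).1.IsLoop := by simp [CartanReal.IsLoop]
      have hY : (Y ^ q).1 = CartanReal.genY ^ q := rfl
      have hA : (Y ^ q * X * (Y ^ q)⁻¹ * X⁻¹).1.area = -q ∧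
          baryAcross u (Y ^ q * X * (Y ^ q)⁻¹ * X⁻¹).1 = q / 2 * u.2 - q ^ 2 / 2 * u.1 := by
        simp only [baryAcross, Subgroup.coe_mul, Subgroup.coe_inv, hY, CartanReal.genY_zpow,
          CartanReal.mul_area, CartanReal.mul_baryX, CartanReal.mul_baryY, CartanReal.det,
          CartanReal.mul_x, CartanReal.mul_y, CartanReal.inv_x, CartanReal.inv_y,
          CartanReal.inv_area, CartanReal.inv_baryX, CartanReal.inv_baryY, coe_X, CartanReal.genX]
        constructor <;> ring
      have e : twist u τ (Y ^ q) j (j + 1) =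
          rayPath u τ j * (Y ^ q * X * (Y ^ q)⁻¹ * X⁻¹) * (rayPath u τ j)⁻¹ := by
        simp only [twist, h']; group
      obtain ⟨-, a2, a3, -⟩ := conj_of_isLoop u hc (rayPath u τ j)
      rw [e, a2, a3, ih.1, hA.1, hA.2, h]
      push_cast
      refine ⟨by ring, ?_⟩
      have b1 := abs_le.1 (abs_across_le h1 h2 h1' h2' τ j)
      have b2 : |(q : ℝ) * (u.2 / 2 - across u (rayPath u τ j).1)| ≤ |(q : ℝ)| * 2 := by
        rw [abs_mul]
        gcongr
        rw [abs_le]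
        constructor <;> linarith
      refine le_trans (le_of_eq ?_) ((abs_add_le _ _).trans (add_le_add ih.2 b2) |>.trans ?_)
      · congr 1; ring
      · linarith
    · have e : twist u τ (Y ^ q) j (j + 1) = 1 := by
        simp only [twist, h', mul_inv_eq_one]; group
      rw [e, h]
      simpa [baryAcross] using! ih

/-- A modification of bounded cost with given negative barycenter across `u`. -/
theorem exists_move_neg {u : ℝ × ℝ} (hu : u.1 ^ 2 + u.2 ^ 2 = 1) (h2 : 0 ≤ u.2) (h3 : u.2 ≤ u.1)
    (τ : Bool) (i : ℕ) {N : ℝ} (hN : 0 ≤ N) : ∃ j f, Move u τ 64 i j f ∧ f.1.area = 0 ∧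
      |baryAcross u f.1 + N| ≤ 640 := by
  have h1 : 1 / 2 ≤ u.1 := by nlinarith
  have h1' : u.1 ≤ 1 := by nlinarith
  have h0 : 0 < u.1 := by linarith
  obtain ⟨e, he0, hem, he⟩ := exists_column_seq h0 h2 h3 τ i
  -- With `|q| = 16` the main term `q²·u.1/2` lies in `[64, 128]` and dominates the error `2|q| =
  -- 32`, hence the bounds `32` and `160` per column.
  have key : ∀ q : ℤ, (q = 16 ∨ q = -16) → ∀ D D' : ℕ, D ≤ D' →
      (twist u τ (Y ^ q) (e D) (e D')).1.area = -q * (D' - D) ∧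
      baryAcross u (twist u τ (Y ^ q) (e D) (e D')).1 ≤ -32 * (D' - D) ∧
      -160 * (D' - D) ≤ baryAcross u (twist u τ (Y ^ q) (e D) (e D')).1 := by
    intro q hq D D' hD
    obtain ⟨a, b⟩ := twist_north h0.le h2 h1' (h3.trans h1') τ q (hem hD)
    have hd : ((rayHat u τ (e D')).1 - (rayHat u τ (e D)).1 : ℝ) = D' - D := by
      rw [he, he]; push_cast; ring
    have hd0 : (0 : ℝ) ≤ D' - D := by
      have : (D : ℝ) ≤ D' := by exact_mod_cast hD
      linarith
    rw [hd] at a b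
    generalize (D' : ℝ) - D = d at *
    have hq1 : (q : ℝ) ^ 2 = 256 := by rcases hq with rfl | rfl <;> norm_num
    have hq2 : |(q : ℝ)| = 16 := by rcases hq with rfl | rfl <;> norm_num
    rw [hq1, hq2] at b
    have b' := abs_le.1 b
    refine ⟨a, ?_, ?_⟩ <;> nlinarith
  -- Shift `D` columns up and the next `D` down: the areas cancel, while both contributions across
  -- `u` are negative.
  set f : ℕ → Cartan := fun D =>
    twist u τ (Y ^ (16 : ℤ)) (e 0) (e D) * twist u τ (Y ^ (-16 : ℤ)) (e D) (e (2 * D)) with hf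
  have hb : ∀ D, baryAcross u (f D).1 = baryAcross u (twist u τ (Y ^ (16 : ℤ)) (e 0) (e D)).1 +
      baryAcross u (twist u τ (Y ^ (-16 : ℤ)) (e D) (e (2 * D))).1 := fun D =>
    baryAcross_mul_of_isLoop u (isLoop_twist _ _ _ _ _) _
  obtain ⟨D, hD⟩ := exists_abs_add_le (f := fun D => baryAcross u (f D).1) (c := 640)
    (by simp [hf, twist_self, baryAcross]) (by
      intro D
      simp only [hb]
      have k1 := key 16 (Or.inl rfl) D (D + 1) (by omega)
      have k2 := key (-16) (Or.inr rfl) D (D + 1) (by omega)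
      have k3 := key (-16) (Or.inr rfl) (2 * D) (2 * (D + 1)) (by omega)
      have e1 := baryAcross_mul_of_isLoop u (isLoop_twist u τ (Y ^ (16 : ℤ)) (e 0) (e D))
        (twist u τ (Y ^ (16 : ℤ)) (e D) (e (D + 1)))
      have e2 := baryAcross_mul_of_isLoop u (isLoop_twist u τ (Y ^ (-16 : ℤ)) (e D) (e (D + 1)))
        (twist u τ (Y ^ (-16 : ℤ)) (e (D + 1)) (e (2 * (D + 1))))
      have e3 := baryAcross_mul_of_isLoop u (isLoop_twist u τ (Y ^ (-16 : ℤ)) (e D) (e (2 * D)))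
        (twist u τ (Y ^ (-16 : ℤ)) (e (2 * D)) (e (2 * (D + 1))))
      rw [twist_mul] at e1 e2 e3
      push_cast at k1 k2 k3
      rw [abs_le]
      constructor <;> linarith [k1.2.1, k1.2.2, k2.2.1, k2.2.2, k3.2.1, k3.2.2]) (by
      intro N
      obtain ⟨D, hD⟩ := exists_nat_ge N
      refine ⟨D, ?_⟩
      have k1 := (key 16 (Or.inl rfl) 0 D (by omega)).2.1
      have k2 := (key (-16) (Or.inr rfl) D (2 * D) (by omega)).2.1
      rw [hb]
      push_cast at k1 k2
      have hD0 : (0 : ℝ) ≤ D := by positivity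
      linarith) hN
  refine ⟨e (2 * D), f D, ?_, ?_, hD⟩
  · obtain ⟨a1, a2, a3⟩ := (move_twist h0.le h2 τ (Y ^ (16 : ℤ)) (hem (Nat.zero_le D))).mul
      (move_twist h0.le h2 τ (Y ^ (-16 : ℤ)) (hem (by omega : D ≤ 2 * D)))
    rw [he0] at a2 a3
    have n1 := norm_Y_zpow_le 16
    have n2 := norm_Y_zpow_le (-16)
    refine ⟨isLoop_twist _ _ _ _ _ |>.mul (isLoop_twist _ _ _ _ _), a2, ?_⟩
    simp only [hf, he0]
    simp only [Int.natAbs_neg, Int.reduceAbs] at n1 n2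
    omega
  · have k1 := (key 16 (Or.inl rfl) 0 D (by omega)).1
    have k2 := (key (-16) (Or.inr rfl) D (2 * D) (by omega)).1
    rw [hf, area_mul_of_isLoop (isLoop_twist _ _ _ _ _), k1, k2]
    push_cast
    ring

/-- A modification of bounded cost with given area. -/
theorem exists_move_area {u : ℝ × ℝ} (hu : u.1 ^ 2 + u.2 ^ 2 = 1) (h2 : 0 ≤ u.2) (h3 : u.2 ≤ u.1)
    (τ : Bool) (i : ℕ) (a : ℝ) : ∃ j f, Move u τ 2 i j f ∧ |f.1.area - a| ≤ 1 ∧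
      |baryAcross u f.1| ≤ 3 * (|a| + 1) := by
  have h1 : 1 / 2 ≤ u.1 := by nlinarith
  have h1' : u.1 ≤ 1 := by nlinarith
  have h0 : 0 < u.1 := by linarith
  obtain ⟨e, he0, hem, he⟩ := exists_column_seq h0 h2 h3 τ i
  obtain ⟨q, hq, hqa⟩ : ∃ q : ℤ, (q = 1 ∨ q = -1) ∧ a = -q * |a| := by
    rcases le_total 0 a with h | h
    · exact ⟨-1, Or.inr rfl, by rw [abs_of_nonneg h]; push_cast; ring⟩
    · exact ⟨1, Or.inl rfl, by rw [abs_of_nonpos h]; push_cast; ring⟩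
  set D := ⌊|a|⌋₊
  have hD1 : (D : ℝ) ≤ |a| := Nat.floor_le (abs_nonneg a)
  have hD2 : |a| < D + 1 := Nat.lt_floor_add_one _
  have hi : i ≤ e D := he0 ▸ hem (Nat.zero_le D)
  obtain ⟨t1, t2⟩ := twist_north h0.le h2 h1' (h3.trans h1') τ q hi
  obtain ⟨m1, m2, m3⟩ := move_twist h0.le h2 τ (Y ^ q) hi
  have hn := norm_Y_zpow_le q
  have hqn : q.natAbs = 1 := by rcases hq with rfl | rfl <;> rfl
  have hq1 : (q : ℝ) ^ 2 = 1 := by rcases hq with rfl | rfl <;> norm_num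
  have hq2 : |(q : ℝ)| = 1 := by rcases hq with rfl | rfl <;> norm_num
  rw [he] at t1 t2
  push_cast at t1 t2
  rw [add_sub_cancel_left] at t1 t2
  rw [hq1, hq2] at t2
  refine ⟨e D, _, ⟨m1, m2, by omega⟩, ?_, ?_⟩
  · rw [t1]
    conv_lhs => rw [hqa]
    rw [← mul_sub, abs_mul, abs_neg, hq2, one_mul, abs_le]
    constructor <;> linarith
  · have t2' := abs_le.1 t2
    have hD0 : (0 : ℝ) ≤ D := by positivity
    rw [abs_le]
    constructor <;> nlinarith

/-! ### Positive barycenter across `u`, and assembly of the upper bound. -/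

/-- A displaced rectangle, minus the rectangle. -/
noncomputable def displacement (a b c : ℕ) : Cartan :=
  Y ^ (c : ℤ) * (X ^ (a : ℤ) * Y ^ (b : ℤ) * (X ^ (a : ℤ))⁻¹ * (Y ^ (b : ℤ))⁻¹) * (Y ^ (c : ℤ))⁻¹ *
    (X ^ (a : ℤ) * Y ^ (b : ℤ) * (X ^ (a : ℤ))⁻¹ * (Y ^ (b : ℤ))⁻¹)⁻¹

/-- Moving an area `ab` north by `c` gives a cubic effect for a linear length. -/
theorem displacement_spec (u : ℝ × ℝ) (a b c : ℕ) : (displacement a b c).1.IsLoop ∧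
    (displacement a b c).1.area = 0 ∧
    baryAcross u (displacement a b c).1 = a * b * c * u.1 ∧
    norm (displacement a b c) ≤ 4 * a + 4 * b + 2 * c := by
  have hl : (X ^ (a : ℤ) * Y ^ (b : ℤ) * (X ^ (a : ℤ))⁻¹ * (Y ^ (b : ℤ))⁻¹).1.IsLoop := by
    simp [CartanReal.IsLoop]
  have hX : (X ^ (a : ℤ)).1 = CartanReal.genX ^ (a : ℤ) := rfl
  have hY : (Y ^ (b : ℤ)).1 = CartanReal.genY ^ (b : ℤ) := rfl
  have hYc : (Y ^ (c : ℤ)).1 = CartanReal.genY ^ (c : ℤ) := rfl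
  have hA : (X ^ (a : ℤ) * Y ^ (b : ℤ) * (X ^ (a : ℤ))⁻¹ * (Y ^ (b : ℤ))⁻¹).1.area = a * b := by
    simp only [Subgroup.coe_mul, Subgroup.coe_inv, hX, hY, CartanReal.genX_zpow,
      CartanReal.genY_zpow, CartanReal.mul_area, CartanReal.det,
      CartanReal.mul_x, CartanReal.mul_y, CartanReal.inv_x, CartanReal.inv_y, CartanReal.inv_area]
    push_cast
    ring
  have hac : across u (Y ^ (c : ℤ)).1 = c * u.1 := by
    rw [across, hYc, CartanReal.genY_zpow]
    simp
  have nx := norm_X_zpow_le a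
  have ny := norm_Y_zpow_le b
  have nc := norm_Y_zpow_le c
  simp only [displacement]
  generalize hv : X ^ (a : ℤ) * Y ^ (b : ℤ) * (X ^ (a : ℤ))⁻¹ * (Y ^ (b : ℤ))⁻¹ = v at *
  have hnv : norm v ≤ 2 * a + 2 * b := by
    rw [← hv]
    have n1 := norm_mul_le (X ^ (a : ℤ) * Y ^ (b : ℤ) * (X ^ (a : ℤ))⁻¹) (Y ^ (b : ℤ))⁻¹
    have n2 := norm_mul_le (X ^ (a : ℤ) * Y ^ (b : ℤ)) (X ^ (a : ℤ))⁻¹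
    have n3 := norm_mul_le (X ^ (a : ℤ)) (Y ^ (b : ℤ))
    rw [norm_inv] at n1 n2
    simp only [Int.natAbs_natCast] at nx ny
    omega
  obtain ⟨c1, c2, c3, -⟩ := conj_of_isLoop u hl (Y ^ (c : ℤ))
  obtain ⟨-, d2, d3, -⟩ := inv_of_isLoop u hl
  refine ⟨c1.mul hl.inv, ?_, ?_, ?_⟩
  · rw [area_mul_of_isLoop c1, c2, d2]; ring
  · rw [baryAcross_mul_of_isLoop u c1, c3, d3, hA, hac]; ring
  · have n1 := norm_mul_le (Y ^ (c : ℤ) * v * (Y ^ (c : ℤ))⁻¹) v⁻¹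
    have n2 := norm_mul_le (Y ^ (c : ℤ) * v) (Y ^ (c : ℤ))⁻¹
    have n3 := norm_mul_le (Y ^ (c : ℤ)) v
    rw [norm_inv] at n1 n2
    simp only [Int.natAbs_natCast] at nc
    omega

/-- A loop with given positive barycenter across `u` and length the cube root of it. -/
theorem exists_loop_pos {u : ℝ × ℝ} (h1 : 1 / 2 ≤ u.1) (h1' : u.1 ≤ 1) {N : ℝ} (hN : 0 ≤ N) :
    ∃ f : Cartan, f.1.IsLoop ∧ f.1.area = 0 ∧ |baryAcross u f.1 - N| ≤ 1 ∧
      (norm f : ℝ) ≤ 60 * N ^ (1 / 3 : ℝ) + 60 := by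
  set m := ⌊N / u.1⌋₊ with hm
  have hu0 : 0 < u.1 := by linarith
  have hm1 : (m : ℝ) ≤ N / u.1 := Nat.floor_le (by positivity)
  have hm2 : N / u.1 < m + 1 := Nat.lt_floor_add_one _
  rw [le_div_iff₀ hu0] at hm1
  rw [div_lt_iff₀ hu0] at hm2
  set r := N ^ (1 / 3 : ℝ) with hr
  have hr0 : 0 ≤ r := by positivity
  have hr3 : r ^ 3 = N := by
    rw [hr, ← Real.rpow_natCast, ← Real.rpow_mul hN]
    norm_num
  set k := ⌊2 * r⌋₊ + 1 with hk
  have hk1 : 2 * r < k := by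
    rw [hk]; push_cast; exact Nat.lt_floor_add_one _
  have hk2 : (k : ℝ) ≤ 2 * r + 1 := by
    rw [hk]; push_cast
    linarith [Nat.floor_le (by positivity : 0 ≤ 2 * r)]
  have hk0 : 0 < k := by omega
  have hmk : m < k * k * k := by
    have h3 : (m : ℝ) ≤ 2 * N := by nlinarith [(Nat.cast_nonneg m : (0 : ℝ) ≤ m)]
    have h4 : (2 * r) ^ 3 < (k : ℝ) ^ 3 := by gcongr
    have h5 : (m : ℝ) < k * k * k := by nlinarith
    exact_mod_cast h5
  have hj : m / k / k < k := by
    rw [Nat.div_lt_iff_lt_mul hk0, Nat.div_lt_iff_lt_mul hk0]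
    exact hmk
  have hl : m / k % k < k := Nat.mod_lt _ hk0
  have hi : m % k < k := Nat.mod_lt _ hk0
  -- Base `k` expansion of `m`. Each digit is realized by one displacement, of a rectangle with
  -- sides `k, k`, then `k, 1`, then `1, 1`; all digits are below `k`, so the total length is
  -- `O(k)`.
  have hdecomp : m = k * k * (m / k / k) + k * 1 * (m / k % k) + 1 * 1 * (m % k) := by
    have e1 := Nat.div_add_mod m k
    have e2 := Nat.div_add_mod (m / k) k
    calc m = k * (k * (m / k / k) + m / k % k) + m % k := by rw [e2, e1]
      _ = _ := by ring
  obtain ⟨a1, a2, a3, a4⟩ := displacement_spec u k k (m / k / k)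
  obtain ⟨b1, b2, b3, b4⟩ := displacement_spec u k 1 (m / k % k)
  obtain ⟨c1, c2, c3, c4⟩ := displacement_spec u 1 1 (m % k)
  refine ⟨displacement k k (m / k / k) * (displacement k 1 (m / k % k) * displacement 1 1 (m % k)),
    a1.mul (b1.mul c1), ?_, ?_, ?_⟩
  · rw [area_mul_of_isLoop a1, area_mul_of_isLoop b1, a2, b2, c2]; ring
  · rw [baryAcross_mul_of_isLoop u a1, baryAcross_mul_of_isLoop u b1, a3, b3, c3]
    have h6 : (m : ℝ) = (k * k * (m / k / k : ℕ) + k * 1 * (m / k % k : ℕ) +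
        1 * 1 * (m % k : ℕ) : ℝ) := by exact_mod_cast hdecomp
    generalize ((m / k / k : ℕ) : ℝ) = x at *
    generalize ((m / k % k : ℕ) : ℝ) = y at *
    generalize ((m % k : ℕ) : ℝ) = z at *
    have h7 : k * k * x * u.1 + (k * (1 : ℕ) * y * u.1 + (1 : ℕ) * (1 : ℕ) * z * u.1) =
        m * u.1 := by
      rw [h6]; push_cast; ring
    rw [h7, abs_le]
    constructor <;> nlinarith
  · have n1 := norm_mul_le (displacement k k (m / k / k))
      (displacement k 1 (m / k % k) * displacement 1 1 (m % k))
    have n2 := norm_mul_le (displacement k 1 (m / k % k)) (displacement 1 1 (m % k))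
    have h8 : norm (displacement k k (m / k / k) *
        (displacement k 1 (m / k % k) * displacement 1 1 (m % k))) ≤ 30 * k := by omega
    have h9 : (norm (displacement k k (m / k / k) *
        (displacement k 1 (m / k % k) * displacement 1 1 (m % k))) : ℝ) ≤ 30 * k := by
      exact_mod_cast h8
    linarith

/-- Such a loop is central, so it can be inserted at any vertex of the ray. -/
theorem move_of_area_eq_zero (u : ℝ × ℝ) (τ : Bool) {f : Cartan} (hf : f.1.IsLoop)
    (hA : f.1.area = 0) (i : ℕ) : Move u τ (norm f) i i f := by
  have h : (rayPath u τ i)⁻¹ * f = f * (rayPath u τ i)⁻¹ :=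
    Subtype.ext (hf.commute hA (rayPath u τ i)⁻¹.1)
  refine ⟨hf, le_rfl, ?_⟩
  rw [h, inv_mul_cancel_right, add_comm]

/-- Write `h⁻¹γ_n = (h⁻¹f⁻¹)(fγ_n)`; for `n ≥ j` the second factor is the modified ray, of length at
most `n + k`. -/
theorem busemann_le_of_move {u : ℝ × ℝ} (h1 : 0 ≤ u.1) (h2 : 0 ≤ u.2) (τ : Bool) {k j : ℕ}
    {f : Cartan} (hf : Move u τ k 0 j f) (h : Cartan) :
    busemann (rayPath u τ) h ≤ norm (h⁻¹ * f⁻¹) + k := by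
  refine busemann_le h1 h2 τ j fun n hn => ?_
  obtain ⟨-, -, f3⟩ := hf
  have a := norm_rayPath_between h1 h2 τ j (n - j)
  rw [Nat.add_sub_cancel' hn] at a
  have b := norm_mul_le (h⁻¹ * f⁻¹) (f * rayPath u τ n)
  have c := norm_mul_le ((rayPath u τ 0)⁻¹ * f * rayPath u τ j)
    ((rayPath u τ j)⁻¹ * rayPath u τ n)
  rw [show h⁻¹ * f⁻¹ * (f * rayPath u τ n) = h⁻¹ * rayPath u τ n by group] at b
  rw [show (rayPath u τ 0)⁻¹ * f * rayPath u τ j * ((rayPath u τ j)⁻¹ * rayPath u τ n) =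
    (rayPath u τ 0)⁻¹ * f * rayPath u τ n by group, show rayPath u τ 0 = 1 from rfl, inv_one,
    one_mul] at c
  rw [show rayPath u τ 0 = 1 from rfl, inv_one, one_mul] at f3
  have : norm (h⁻¹ * rayPath u τ n) ≤ n + (norm (h⁻¹ * f⁻¹) + k) := by omega
  exact_mod_cast this

/-- An upper bound for the horofunction, given modifications with prescribed area. -/
theorem exists_busemann_le {u : ℝ × ℝ} (hu : u.1 ^ 2 + u.2 ^ 2 = 1) (h2 : 0 ≤ u.2)
    (h3 : u.2 ≤ u.1) (τ : Bool) {k₀ : ℕ} {G : ℝ → ℝ}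
    (hG : ∀ a : ℝ, ∃ j f, Move u τ k₀ 0 j f ∧ |f.1.area - a| ≤ 1 ∧ |baryAcross u f.1| ≤ G a) :
    ∃ C : ℝ, 0 < C ∧ ∀ h : Cartan, h.1.IsLoop → busemann (rayPath u τ) h ≤
      60 * (max (-baryAcross u h.1 + G (-h.1.area)) 0) ^ (1 / 3 : ℝ) + C := by
  have h1 : 1 / 2 ≤ u.1 := by nlinarith
  have h1' : u.1 ≤ 1 := by nlinarith
  have h0 : 0 < u.1 := by linarith
  obtain ⟨M, hM⟩ := exists_norm_le_of_bounded 1000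
  refine ⟨M + k₀ + 200, by positivity, fun h hh => ?_⟩
  obtain ⟨i1, i2, i3, i4⟩ := inv_of_isLoop u hh
  obtain ⟨j₁, f₁, m₁, a₁, b₁⟩ := hG (-h.1.area)
  -- With the area settled by `f₁`, correct the barycenter across `u`. Only a positive deficit has
  -- unbounded cost.
  have mid : ∃ (k₂ j₂ : ℕ) (f₂ : Cartan), Move u τ k₂ j₁ j₂ f₂ ∧ f₂.1.area = 0 ∧
      |baryAcross u f₂.1 - (-baryAcross u h.1 - baryAcross u f₁.1)| ≤ 640 ∧
      (k₂ : ℝ) ≤ 60 * (max (-baryAcross u h.1 + G (-h.1.area)) 0) ^ (1 / 3 : ℝ) + 64 := by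
    rcases le_total 0 (-baryAcross u h.1 - baryAcross u f₁.1) with hp | hp
    · obtain ⟨f₂, c1, c2, c3, c4⟩ := exists_loop_pos h1 h1' hp
      refine ⟨_, _, f₂, move_of_area_eq_zero u τ c1 c2 j₁, c2, c3.trans (by norm_num), ?_⟩
      have : (-baryAcross u h.1 - baryAcross u f₁.1) ^ (1 / 3 : ℝ) ≤
          (max (-baryAcross u h.1 + G (-h.1.area)) 0) ^ (1 / 3 : ℝ) := by
        apply Real.rpow_le_rpow hp _ (by norm_num)
        refine le_trans ?_ (le_max_left _ _)
        linarith [(abs_le.1 b₁).1]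
      linarith
    · obtain ⟨j₂, f₂, c1, c2, c3⟩ := exists_move_neg hu h2 h3 τ j₁
        (by linarith : 0 ≤ -(-baryAcross u h.1 - baryAcross u f₁.1))
      refine ⟨64, j₂, f₂, c1, c2, by rwa [← sub_eq_add_neg] at c3, ?_⟩
      have : 0 ≤ (max (-baryAcross u h.1 + G (-h.1.area)) 0) ^ (1 / 3 : ℝ) :=
        Real.rpow_nonneg (le_max_right _ _) _
      push_cast
      linarith
  obtain ⟨k₂, j₂, f₂, m₂, a₂, b₂, hk₂⟩ := mid
  -- The barycenter along `u` comes last, since this correction leaves the area unchanged and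
  -- disturbs the other coordinate by at most `2`.
  obtain ⟨j₃, f₃, m₃, a₃, b₃, q₃⟩ := exists_move_along hu h2 h3 τ j₂
    (-baryAlong u h.1 - baryAlong u f₁.1 - baryAlong u f₂.1)
  have mF := (m₁.mul m₂).mul m₃
  have l12 := m₁.1.mul m₂.1
  have aF : (f₁ * f₂ * f₃).1.area = f₁.1.area := by
    rw [area_mul_of_isLoop l12, area_mul_of_isLoop m₁.1, a₂, a₃]; ring
  have bF : baryAcross u (f₁ * f₂ * f₃).1 =
      baryAcross u f₁.1 + baryAcross u f₂.1 + baryAcross u f₃.1 := by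
    rw [baryAcross_mul_of_isLoop u l12, baryAcross_mul_of_isLoop u m₁.1]
  have qF : baryAlong u (f₁ * f₂ * f₃).1 =
      baryAlong u f₁.1 + baryAlong u f₂.1 + baryAlong u f₃.1 := by
    rw [baryAlong_mul_of_isLoop u l12, baryAlong_mul_of_isLoop u m₁.1]
  obtain ⟨n1, n2, n3, n4⟩ := inv_of_isLoop u mF.1
  have rA : |(h⁻¹ * (f₁ * f₂ * f₃)⁻¹).1.area| ≤ 1 := by
    rw [area_mul_of_isLoop i1, i2, n2, aF, ← sub_eq_add_neg, abs_sub_comm]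
    exact a₁
  have rP : |baryAcross u (h⁻¹ * (f₁ * f₂ * f₃)⁻¹).1| ≤ 642 := by
    rw [baryAcross_mul_of_isLoop u i1, i3, n3, bF]
    have := abs_le.1 b₂
    have := abs_le.1 b₃
    rw [abs_le]
    constructor <;> linarith
  have rQ : |baryAlong u (h⁻¹ * (f₁ * f₂ * f₃)⁻¹).1| ≤ 1 := by
    rw [baryAlong_mul_of_isLoop u i1, i4, n4, qF]
    have := abs_le.1 q₃
    rw [abs_le]
    constructor <;> linarith
  have hnorm : norm (h⁻¹ * (f₁ * f₂ * f₃)⁻¹) ≤ M := by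
    apply hM _ (i1.mul n1) (rA.trans (by norm_num))
    all_goals
      simp only [baryAcross, baryAlong] at rP rQ
      generalize (h⁻¹ * (f₁ * f₂ * f₃)⁻¹).1.baryX = x at *
      generalize (h⁻¹ * (f₁ * f₂ * f₃)⁻¹).1.baryY = y at *
      have hP := abs_le.1 rP
      have hQ := abs_le.1 rQ
      have hsq : x ^ 2 + y ^ 2 = (y * u.1 - x * u.2) ^ 2 + (x * u.1 + y * u.2) ^ 2 := by
        linear_combination -(x ^ 2 + y ^ 2) * hu
      apply abs_le_of_sq_le_sq _ (by norm_num)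
      nlinarith
  have key := busemann_le_of_move h0.le h2 τ mF h
  have : (norm (h⁻¹ * (f₁ * f₂ * f₃)⁻¹) : ℝ) ≤ M := by exact_mod_cast hnorm
  push_cast at key
  linarith

/-! ### Corners of the ray close to the line -/

theorem height_step {u : ℝ × ℝ} (h1 : 0 ≤ u.1) (h2 : 0 ≤ u.2) (τ : Bool) (n : ℕ) :
    (rayPath u τ (n + 1) = rayPath u τ n * X ∧ 0 ≤ height u (rayHat u τ n) ∧
      height u (rayHat u τ (n + 1)) = height u (rayHat u τ n) - u.2) ∨
    (rayPath u τ (n + 1) = rayPath u τ n * Y ∧ height u (rayHat u τ n) ≤ 0 ∧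
      height u (rayHat u τ (n + 1)) = height u (rayHat u τ n) + u.1) := by
  rcases rayHat_succ h1 h2 τ n with ⟨h, h', h''⟩ | ⟨h, h', h''⟩
  · refine Or.inl ⟨h', h'', ?_⟩
    rw [h]; simp only [height]; push_cast; ring
  · refine Or.inr ⟨h', h'', ?_⟩
    rw [h]; simp only [height]; push_cast; ring

/-- Passing a square on its other side also takes two steps, so it is free. -/
theorem move_conj_of_corner {u : ℝ × ℝ} {τ : Bool} {i : ℕ} {c : Cartan} (hc : c.1.IsLoop)
    (h : norm (c * ((rayPath u τ i)⁻¹ * rayPath u τ (i + 2))) ≤ 2) :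
    Move u τ 0 i (i + 2) (rayPath u τ i * c * (rayPath u τ i)⁻¹) := by
  refine ⟨(conj_of_isLoop u hc _).1, by omega, ?_⟩
  rw [show (rayPath u τ i)⁻¹ * (rayPath u τ i * c * (rayPath u τ i)⁻¹) * rayPath u τ (i + 2) =
    c * ((rayPath u τ i)⁻¹ * rayPath u τ (i + 2)) by group]
  omega

/-- Moving a corner of the ray across the square above it. -/
theorem exists_move_of_corner_east {u : ℝ × ℝ} (h1 : 0 ≤ u.1) (h2 : 0 ≤ u.2) {τ : Bool} {i : ℕ}
    (hX : rayPath u τ (i + 1) = rayPath u τ i * X)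
    (hY : rayPath u τ (i + 1 + 1) = rayPath u τ (i + 1) * Y) :
    ∃ f, Move u τ 0 i (i + 2) f ∧ f.1.area = -1 ∧
      baryAcross u f.1 = -height u (rayHat u τ i) := by
  have hc : (Y * X * Y⁻¹ * X⁻¹).1.IsLoop := by simp [CartanReal.IsLoop]
  obtain ⟨-, a2, a3, -⟩ := conj_of_isLoop u hc (rayPath u τ i)
  have hA : (Y * X * Y⁻¹ * X⁻¹).1.area = -1 ∧
      baryAcross u (Y * X * Y⁻¹ * X⁻¹).1 = (u.2 - u.1) / 2 := by
    simp only [baryAcross, Subgroup.coe_mul, Subgroup.coe_inv,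
      CartanReal.mul_area, CartanReal.mul_baryX, CartanReal.mul_baryY, CartanReal.det,
      CartanReal.mul_x, CartanReal.mul_y, CartanReal.inv_x, CartanReal.inv_y,
      CartanReal.inv_area, CartanReal.inv_baryX, CartanReal.inv_baryY, coe_X, coe_Y,
      CartanReal.genX, CartanReal.genY]
    constructor <;> ring
  refine ⟨_, move_conj_of_corner hc ?_, by rw [a2, hA.1], ?_⟩
  · rw [hY, hX, show Y * X * Y⁻¹ * X⁻¹ * ((rayPath u τ i)⁻¹ * (rayPath u τ i * X * Y)) = Y * X by
      group]
    exact (norm_mul_le _ _).trans (add_le_add norm_Y_le norm_X_le)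
  · rw [a3, hA.1, hA.2, across_eq_height h1 h2]
    ring

/-- Moving a corner of the ray across the square below it. -/
theorem exists_move_of_corner_north {u : ℝ × ℝ} (h1 : 0 ≤ u.1) (h2 : 0 ≤ u.2) {τ : Bool} {i : ℕ}
    (hY : rayPath u τ (i + 1) = rayPath u τ i * Y)
    (hX : rayPath u τ (i + 1 + 1) = rayPath u τ (i + 1) * X) :
    ∃ f, Move u τ 0 i (i + 2) f ∧ f.1.area = 1 ∧
      baryAcross u f.1 = height u (rayHat u τ i) := by
  have hc : (X * Y * X⁻¹ * Y⁻¹).1.IsLoop := by simp [CartanReal.IsLoop]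
  obtain ⟨-, a2, a3, -⟩ := conj_of_isLoop u hc (rayPath u τ i)
  have hA : (X * Y * X⁻¹ * Y⁻¹).1.area = 1 ∧
      baryAcross u (X * Y * X⁻¹ * Y⁻¹).1 = (u.1 - u.2) / 2 := by
    simp only [baryAcross, Subgroup.coe_mul, Subgroup.coe_inv,
      CartanReal.mul_area, CartanReal.mul_baryX, CartanReal.mul_baryY, CartanReal.det,
      CartanReal.mul_x, CartanReal.mul_y, CartanReal.inv_x, CartanReal.inv_y,
      CartanReal.inv_area, CartanReal.inv_baryX, CartanReal.inv_baryY, coe_X, coe_Y,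
      CartanReal.genX, CartanReal.genY]
    constructor <;> ring
  refine ⟨_, move_conj_of_corner hc ?_, by rw [a2, hA.1], ?_⟩
  · rw [hX, hY, show X * Y * X⁻¹ * Y⁻¹ * ((rayPath u τ i)⁻¹ * (rayPath u τ i * Y * X)) = X * Y by
      group]
    exact (norm_mul_le _ _).trans (add_le_add norm_X_le norm_Y_le)
  · rw [a3, hA.1, hA.2, across_eq_height h1 h2]
    ring

theorem exists_move_nsmul {u : ℝ × ℝ} (h1 : 0 ≤ u.1) (h2 : 0 ≤ u.2) {τ : Bool} {s ε : ℝ}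
    (H : ∀ i, ∃ j f, Move u τ 0 i j f ∧ f.1.area = s ∧ |baryAcross u f.1| ≤ ε) (n : ℕ) :
    ∃ j f, Move u τ 0 0 j f ∧ f.1.area = n * s ∧ |baryAcross u f.1| ≤ n * ε := by
  induction n with
  | zero => exact ⟨0, 1, Move.one u τ h1 h2 le_rfl, by simp, by simp [baryAcross]⟩
  | succ n ih =>
    obtain ⟨j, f, a1, a2, a3⟩ := ih
    obtain ⟨l, g, b1, b2, b3⟩ := H j
    refine ⟨l, f * g, a1.mul b1, ?_, ?_⟩
    · rw [area_mul_of_isLoop a1.1, a2, b2]; push_cast; ring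
    · rw [baryAcross_mul_of_isLoop u a1.1]
      refine (abs_add_le _ _).trans ((add_le_add a3 b3).trans (le_of_eq ?_))
      push_cast; ring

/-- If the ray has corners arbitrarily close to the line on both sides, then the area can be changed
without changing the barycenter across `u`. -/
theorem exists_flat_move {u : ℝ × ℝ} (h1 : 0 ≤ u.1) (h2 : 0 ≤ u.2) {τ : Bool}
    (H : ∀ ε : ℝ, 0 < ε → ∀ i, (∃ j f, Move u τ 0 i j f ∧ f.1.area = 1 ∧ |baryAcross u f.1| ≤ ε) ∧
      ∃ j f, Move u τ 0 i j f ∧ f.1.area = -1 ∧ |baryAcross u f.1| ≤ ε) (a : ℝ) :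
    ∃ j f, Move u τ 0 0 j f ∧ |f.1.area - a| ≤ 1 ∧ |baryAcross u f.1| ≤ 1 := by
  set n := ⌊|a|⌋₊
  have hn1 : (n : ℝ) ≤ |a| := Nat.floor_le (abs_nonneg a)
  have hn2 : |a| < n + 1 := Nat.lt_floor_add_one _
  have hn0 : (0 : ℝ) ≤ n := by positivity
  have hε : (n : ℝ) * (1 / (n + 1)) ≤ 1 := by
    rw [mul_one_div]
    exact div_le_one_of_le₀ (by linarith) (by linarith)
  have H' := H (1 / (n + 1)) (by positivity)
  rcases le_total 0 a with ha | ha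
  · obtain ⟨j, f, b1, b2, b3⟩ := exists_move_nsmul h1 h2 (fun i => (H' i).1) n
    rw [abs_of_nonneg ha] at hn1 hn2
    refine ⟨j, f, b1, ?_, b3.trans hε⟩
    rw [b2, abs_le]
    constructor <;> linarith
  · obtain ⟨j, f, b1, b2, b3⟩ := exists_move_nsmul h1 h2 (fun i => (H' i).2) n
    rw [abs_of_nonpos ha] at hn1 hn2
    refine ⟨j, f, b1, ?_, b3.trans hε⟩
    rw [b2, abs_le]
    constructor <;> linarith

/-- The ray passes at the lower left corner of all the squares with center close to the line. -/
theorem height_eq_of_mem {u : ℝ × ℝ} (h1 : 0 < u.1) (h2 : 0 < u.2) (τ : Bool) {n : ℕ} {z : ℤ}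
    (hl : -u.2 < n * u.1 - z * (u.1 + u.2) + (u.1 - u.2) / 2)
    (hr : n * u.1 - z * (u.1 + u.2) + (u.1 - u.2) / 2 < u.1) :
    height u (rayHat u τ n) = n * u.1 - z * (u.1 + u.2) + (u.1 - u.2) / 2 := by
  have hs := rayHat_sum h1.le h2.le τ n
  have hb := rayHat_height h1.le h2.le τ n
  have hs' : ((rayHat u τ n).2 : ℝ) = n - (rayHat u τ n).1 := by
    have : (rayHat u τ n).2 = n - (rayHat u τ n).1 := by omega
    exact_mod_cast this
  rw [height, hs'] at hb ⊢
  -- As `x + y = n`, changing the abscissa by one changes the height by `u.1 + u.2`, the full width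
  -- of the allowed interval; so only one abscissa is possible.
  have hz : (rayHat u τ n).1 = z := by
    apply le_antisymm
    · have : ((rayHat u τ n).1 : ℝ) < z + 1 := by
        by_contra hcon
        nlinarith
      have : (rayHat u τ n).1 < z + 1 := by exact_mod_cast this
      omega
    · have : (z : ℝ) < (rayHat u τ n).1 + 1 := by
        by_contra hcon
        nlinarith
      have : z < (rayHat u τ n).1 + 1 := by exact_mod_cast this
      omega
  rw [hz]
  ring

/-- Modulo `u.1 + u.2` the heights form an orbit of the rotation by `u.1`, which returns infinitely
often to every interval when the ratio is irrational. -/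
theorem exists_height_mem_Ioo {u : ℝ × ℝ} (h1 : 0 < u.1) (h2 : 0 < u.2) (τ : Bool)
    (hirr : Irrational (u.1 / (u.1 + u.2))) {a b : ℝ} (hab : a < b) (ha : -u.2 ≤ a) (hb : b ≤ u.1)
    (i : ℕ) : ∃ n, i ≤ n ∧ a < height u (rayHat u τ n) ∧ height u (rayHat u τ n) < b := by
  have : Fact (0 < u.1 + u.2) := ⟨by linarith⟩
  set c := (u.1 - u.2) / 2 with hc
  have hd := AddCircle.denseRange_zsmul_coe_iff.2 hirr
  have hcl : MapClusterPt (((a + b) / 2 - c : ℝ) : AddCircle (u.1 + u.2)) atTop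
      (fun n : ℕ => n • (u.1 : AddCircle (u.1 + u.2))) :=
    ((mapClusterPt_atTop_nsmul_tfae _ _).out 3 0).1 (hd _)
  have hopen : IsOpen ((fun x : ℝ => (x : AddCircle (u.1 + u.2))) '' Set.Ioo (a - c) (b - c)) :=
    QuotientAddGroup.isOpenMap_coe _ isOpen_Ioo
  have hmem := hopen.mem_nhds (x := (((a + b) / 2 - c : ℝ) : AddCircle (u.1 + u.2)))
    ⟨(a + b) / 2 - c, ⟨by linarith, by linarith⟩, rfl⟩
  obtain ⟨n, hn, v, hv, hvn⟩ := frequently_atTop.1 (hcl.frequently hmem) i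
  have hvn' : ((n * u.1 - v : ℝ) : AddCircle (u.1 + u.2)) = 0 := by
    have : (v : AddCircle (u.1 + u.2)) = n • (u.1 : AddCircle (u.1 + u.2)) := hvn
    rw [AddCircle.coe_sub, this, ← AddCircle.coe_nsmul, nsmul_eq_mul, sub_self]
  obtain ⟨z, hz⟩ := (AddCircle.coe_eq_zero_iff _).1 hvn'
  rw [zsmul_eq_mul] at hz
  have hv' : n * u.1 - z * (u.1 + u.2) + (u.1 - u.2) / 2 = v + c := by rw [← hc]; linarith
  have := height_eq_of_mem h1 h2 τ (n := n) (z := z) (by rw [hv']; linarith [hv.1])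
    (by rw [hv']; linarith [hv.2])
  rw [hv'] at this
  exact ⟨n, hn, by rw [this]; linarith [hv.1], by rw [this]; linarith [hv.2]⟩

theorem exists_flat_move_of_irrational {u : ℝ × ℝ} (h1 : 0 < u.1) (h2 : 0 < u.2) (τ : Bool)
    (hirr : Irrational (u.1 / (u.1 + u.2))) (a : ℝ) :
    ∃ j f, Move u τ 0 0 j f ∧ |f.1.area - a| ≤ 1 ∧ |baryAcross u f.1| ≤ 1 := by
  refine exists_flat_move h1.le h2.le (fun ε hε i => ⟨?_, ?_⟩) a
  -- A height in `(-u.1, 0)` forces a north step followed by an east one, hence a corner. The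
  -- minimum with `u.2` keeps the window in the range of heights.
  · obtain ⟨n, hn, a1, a2⟩ := exists_height_mem_Ioo h1 h2 τ hirr
      (a := -min ε (min u.1 u.2)) (b := 0) (by simp [hε, h1, h2])
      (neg_le_neg ((min_le_right _ _).trans (min_le_right _ _))) h1.le i
    rcases height_step h1.le h2.le τ n with ⟨_, b, _⟩ | ⟨b, _, b'⟩
    · linarith
    rcases height_step h1.le h2.le τ (n + 1) with ⟨c, _, _⟩ | ⟨_, c, _⟩
    · obtain ⟨f, f1, f2, f3⟩ := exists_move_of_corner_north h1.le h2.le b c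
      refine ⟨_, f, f1.extend_left h1.le h2.le hn, f2, ?_⟩
      rw [f3, abs_of_neg a2]
      linarith [min_le_left ε (min u.1 u.2)]
    · linarith [(min_le_right ε (min u.1 u.2)).trans (min_le_left _ _)]
  · obtain ⟨n, hn, a1, a2⟩ := exists_height_mem_Ioo h1 h2 τ hirr
      (a := 0) (b := min ε (min u.1 u.2)) (by simp [hε, h1, h2]) (by linarith)
      ((min_le_right _ _).trans (min_le_left _ _)) i
    rcases height_step h1.le h2.le τ n with ⟨b, _, b'⟩ | ⟨_, b, _⟩
    · rcases height_step h1.le h2.le τ (n + 1) with ⟨_, c, _⟩ | ⟨c, _, _⟩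
      · linarith [(min_le_right ε (min u.1 u.2)).trans (min_le_right _ _)]
      · obtain ⟨f, f1, f2, f3⟩ := exists_move_of_corner_east h1.le h2.le b c
        refine ⟨_, f, f1.extend_left h1.le h2.le hn, f2, ?_⟩
        rw [f3, abs_neg, abs_of_pos a1]
        linarith [min_le_left ε (min u.1 u.2)]
    · linarith

theorem rayState_snd_eq {u : ℝ × ℝ} (h1 : 0 ≤ u.1) (h2 : 0 ≤ u.2) (τ : Bool) {i j : ℕ}
    (hij : i ≤ j) (h : ∀ n, i ≤ n → n < j → height u (rayHat u τ n) ≠ 0) :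
    (rayState u τ j).2 = (rayState u τ i).2 := by
  induction j, hij using Nat.le_induction with
  | base => rfl
  | succ j hij ih =>
    rw [← ih fun n hn hn' => h n hn (by omega)]
    have := h j hij (by omega)
    rcases rayState_succ h1 h2 τ j with ⟨-, a | a⟩ | ⟨-, a | a⟩
    exacts [a.2, absurd a.1 this, a.2, absurd a.1 this]

/-- If the ray passes infinitely often at a square whose center is on the line, then it passes
infinitely often on each side. -/
theorem exists_height_eq_zero_and {u : ℝ × ℝ} (h1 : 0 ≤ u.1) (h2 : 0 ≤ u.2) (τ : Bool)
    (H : ∀ i, ∃ n, i ≤ n ∧ height u (rayHat u τ n) = 0) (b : Bool) (i : ℕ) :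
    ∃ n, i ≤ n ∧ height u (rayHat u τ n) = 0 ∧ (rayState u τ n).2 = b := by
  classical
  obtain ⟨n, hn, h0⟩ := H i
  by_cases hb : (rayState u τ n).2 = b
  · exact ⟨n, hn, h0, hb⟩
  have hb' : (rayState u τ (n + 1)).2 = b := by
    rcases rayState_succ h1 h2 τ n with ⟨-, a | ⟨-, a, a'⟩⟩ | ⟨-, a | ⟨-, a, a'⟩⟩
    · exact absurd h0 a.1.ne'
    · rw [a']; rw [a] at hb; cases b <;> simp_all
    · exact absurd h0 a.1.ne
    · rw [a']; rw [a] at hb; cases b <;> simp_all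
  -- The visit at time `n` has flipped the Boolean to `b`, and it stays so until the next visit.
  have hex := H (n + 1)
  refine ⟨Nat.find hex, ?_, (Nat.find_spec hex).2, ?_⟩
  · have := (Nat.find_spec hex).1
    omega
  · rw [rayState_snd_eq h1 h2 τ (Nat.find_spec hex).1, hb']
    intro m hm hm' h
    exact Nat.find_min hex hm' ⟨hm, h⟩

theorem exists_flat_move_of_odd {u : ℝ × ℝ} (h1 : 0 < u.1) (h2 : 0 < u.2) (τ : Bool) {a b : ℤ}
    (ha : Odd a) (hb : Odd b) (hab : HasDirection u a b) (c : ℝ) :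
    ∃ j f, Move u τ 0 0 j f ∧ |f.1.area - c| ≤ 1 ∧ |baryAcross u f.1| ≤ 1 := by
  obtain ⟨t, ht, rfl⟩ := hab
  simp only at h1 h2
  have ha0 : 0 < a := by
    have := pos_of_mul_pos_right h1 ht.le
    exact_mod_cast this
  have hb0 : 0 < b := by
    have := pos_of_mul_pos_right h2 ht.le
    exact_mod_cast this
  obtain ⟨a', ha'⟩ := ha
  obtain ⟨b', hb'⟩ := hb
  have H : ∀ i, ∃ n, i ≤ n ∧ height (t * a, t * b) (rayHat (t * a, t * b) τ n) = 0 := by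
    intro i
    have hn : 0 ≤ a' + a * i + (b' + b * i) := by
      have : 0 ≤ a * i := by positivity
      have : 0 ≤ b * i := by positivity
      omega
    have hi : (i : ℤ) ≤ a' + a * i + (b' + b * i) := by
      have : (i : ℤ) ≤ a * i := by nlinarith
      have : 0 ≤ b * i := by positivity
      omega
    -- The square at `(a' + a i, b' + b i)` has center `(i + 1/2)(a, b)`, because `a = 2a' + 1` and
    -- `b = 2b' + 1`.
    refine ⟨(a' + a * i + (b' + b * i)).toNat, by omega, ?_⟩
    have hcast : (((a' + a * i + (b' + b * i)).toNat : ℕ) : ℝ) = a' + a * i + (b' + b * i) := by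
      have : (((a' + a * i + (b' + b * i)).toNat : ℕ) : ℤ) = a' + a * i + (b' + b * i) := by omega
      exact_mod_cast this
    have haR : (a : ℝ) = 2 * a' + 1 := by exact_mod_cast ha'
    have hbR : (b : ℝ) = 2 * b' + 1 := by exact_mod_cast hb'
    have hz : (((a' + a * i + (b' + b * i)).toNat : ℕ) : ℝ) * (t * a) -
        ((a' + a * i : ℤ) : ℝ) * (t * a + t * b) + (t * a - t * b) / 2 = 0 := by
      rw [hcast]
      push_cast
      rw [haR, hbR]
      ring
    have := height_eq_of_mem (u := (t * a, t * b)) h1 h2 τ (z := a' + a * i)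
      (n := (a' + a * i + (b' + b * i)).toNat) (by simp only [hz]; linarith)
      (by simp only [hz]; linarith)
    rw [this]
    exact hz
  refine exists_flat_move (u := (t * a, t * b)) h1.le h2.le (fun ε hε i => ⟨?_, ?_⟩) c
  · obtain ⟨n, hn, h0, hs⟩ := exists_height_eq_zero_and (u := (t * a, t * b)) h1.le h2.le τ H false i
    rcases rayState_succ (u := (t * a, t * b)) h1.le h2.le τ n with ⟨-, p | p⟩ | ⟨p, -⟩
    · exact absurd h0 p.1.ne'
    · rw [hs] at p; simp at p
    rcases rayHat_succ (u := (t * a, t * b)) h1.le h2.le τ n with ⟨q, -⟩ | ⟨-, q, -⟩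
    · rw [p] at q; simp at q
    rcases height_step (u := (t * a, t * b)) h1.le h2.le τ n with ⟨q', -, -⟩ | ⟨-, -, r⟩
    · rw [q] at q'
      have := congrArg (fun g : Cartan => g.1.x) q'
      simp [coe_X, coe_Y, CartanReal.genX, CartanReal.genY] at this
    rcases height_step (u := (t * a, t * b)) h1.le h2.le τ (n + 1) with ⟨q', -, -⟩ | ⟨-, q', -⟩
    · obtain ⟨f, f1, f2, f3⟩ := exists_move_of_corner_north (u := (t * a, t * b)) h1.le h2.le q q'
      exact ⟨_, f, f1.extend_left h1.le h2.le hn, f2, by rw [f3, h0, abs_zero]; exact hε.le⟩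
    · simp only at r; linarith
  · obtain ⟨n, hn, h0, hs⟩ := exists_height_eq_zero_and (u := (t * a, t * b)) h1.le h2.le τ H true i
    rcases rayState_succ (u := (t * a, t * b)) h1.le h2.le τ n with ⟨p, -⟩ | ⟨-, p | p⟩
    rotate_left
    · exact absurd h0 p.1.ne
    · rw [hs] at p; simp at p
    rcases rayHat_succ (u := (t * a, t * b)) h1.le h2.le τ n with ⟨-, q, -⟩ | ⟨q, -⟩
    rotate_left
    · rw [p] at q; simp at q
    rcases height_step (u := (t * a, t * b)) h1.le h2.le τ n with ⟨-, -, r⟩ | ⟨q', -, -⟩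
    rotate_left
    · rw [q] at q'
      have := congrArg (fun g : Cartan => g.1.x) q'
      simp [coe_X, coe_Y, CartanReal.genX, CartanReal.genY] at this
    rcases height_step (u := (t * a, t * b)) h1.le h2.le τ (n + 1) with ⟨-, q', -⟩ | ⟨q', -, -⟩
    · simp only at r; linarith
    · obtain ⟨f, f1, f2, f3⟩ := exists_move_of_corner_east (u := (t * a, t * b)) h1.le h2.le q q'
      exact ⟨_, f, f1.extend_left h1.le h2.le hn, f2,
        by rw [f3, h0, neg_zero, abs_zero]; exact hε.le⟩

theorem exists_flat_move_of_direction {u : ℝ × ℝ} (hu : u.1 ^ 2 + u.2 ^ 2 = 1) (h2 : 0 ≤ u.2)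
    (h3 : u.2 ≤ u.1) (τ : Bool)
    (hdir : ¬ ∃ a b : ℤ, Xor (Even a) (Even b) ∧ HasDirection u a b) (c : ℝ) :
    ∃ j f, Move u τ 0 0 j f ∧ |f.1.area - c| ≤ 1 ∧ |baryAcross u f.1| ≤ 1 := by
  have h1 : 0 < u.1 := by nlinarith
  have h2' : 0 < u.2 := by
    refine h2.lt_of_ne' fun h => hdir ⟨1, 0, Or.inr ⟨by decide, by decide⟩, u.1, h1, ?_⟩
    ext <;> simp [h]
  by_cases hirr : Irrational (u.1 / (u.1 + u.2))
  · exact exists_flat_move_of_irrational h1 h2' τ hirr c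
  · obtain ⟨q, hq⟩ : ∃ q : ℚ, (q : ℝ) = u.1 / (u.1 + u.2) := by
      simpa [Irrational] using hirr
    have hden : (0 : ℝ) < q.den := by exact_mod_cast q.den_pos
    have hs : 0 < u.1 + u.2 := by linarith
    have hq' : (q.num : ℝ) * (u.1 + u.2) = u.1 * q.den := by
      rw [Rat.cast_def, div_eq_div_iff hden.ne' hs.ne'] at hq
      exact hq
    -- These integers are coprime, so not both even; as mixed parity is excluded, both are odd.
    have hd : HasDirection u q.num (q.den - q.num) := by
      refine ⟨(u.1 + u.2) / q.den, by positivity, ?_⟩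
      ext
      · simp only []
        field_simp
        linarith
      · simp only []
        push_cast
        field_simp
        linarith
    have hcop := q.reduced
    have hne : ¬ (Even q.num ∧ Even ((q.den : ℤ) - q.num)) := by
      rintro ⟨e1, e2⟩
      have e3 : Even (q.den : ℤ) := by simpa using e2.add e1
      have d1 : 2 ∣ q.num.natAbs := by
        have := e1.two_dvd; omega
      have d2 : 2 ∣ q.den := by
        have := e3.two_dvd; omega
      have := Nat.dvd_gcd d1 d2
      rw [hcop] at this
      omega
    have hxor : ¬ Xor (Even q.num) (Even ((q.den : ℤ) - q.num)) := fun h => hdir ⟨_, _, h, hd⟩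
    have hodd : Odd q.num ∧ Odd ((q.den : ℤ) - q.num) := by
      rw [← Int.not_even_iff_odd, ← Int.not_even_iff_odd]
      simp only [Xor] at hxor
      tauto
    exact exists_flat_move_of_odd h1 h2' τ hodd.1 hodd.2 hd c

/-! ### The estimates in the octant `0 ≤ u₂ ≤ u₁` -/

/-- The estimates of the main theorem, for all the elements with trivial second endpoint. -/
def Estimates (u : ℝ × ℝ) (τ : Bool) : Prop :=
  (∀ g : Cartan,
    Tendsto (fun n : ℕ => (dist (rayPath u τ n) g : ℝ) - (dist (rayPath u τ n) 1 : ℝ))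
      atTop (𝓝 (busemann (rayPath u τ) g))) ∧
  ∃ C₁ C₂ : ℝ, 0 < C₁ ∧ 0 < C₂ ∧
    (∀ h : Cartan, h.1.IsLoop →
      (0 ≤ dot (-B h) (perp u) →
        C₁ * dot (-B h) (perp u) ^ (1 / 3 : ℝ) ≤ busemann (rayPath u τ) h ∧
        busemann (rayPath u τ) h ≤ C₂ * (dot (-B h) (perp u) + |A h|) ^ (1 / 3 : ℝ) + C₂) ∧
      (dot (-B h) (perp u) ≤ 0 →
        0 ≤ busemann (rayPath u τ) h ∧
        busemann (rayPath u τ) h ≤ C₂ * |A h| ^ (1 / 3 : ℝ) + C₂)) ∧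
    ((¬ ∃ a b : ℤ, Xor (Even a) (Even b) ∧ HasDirection u a b) →
      ∀ h : Cartan, h.1.IsLoop →
        (0 < dot (-B h) (perp u) →
          C₁ * dot (-B h) (perp u) ^ (1 / 3 : ℝ) ≤ busemann (rayPath u τ) h ∧
          busemann (rayPath u τ) h ≤ C₂ * dot (-B h) (perp u) ^ (1 / 3 : ℝ) + C₂) ∧
        (dot (-B h) (perp u) ≤ 0 → |busemann (rayPath u τ) h| ≤ C₂)) ∧
    ((∃ a b : ℤ, Odd a ∧ Odd b ∧ HasDirection u a b) →
      ∀ h : Cartan, h.1.IsLoop → 0 < dot (-B h) (perp u) →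
        busemann (rayPath u τ) h ≤ C₂ * dot (-B h) (perp u) ^ (1 / 3 : ℝ))

theorem dot_neg_B (u : ℝ × ℝ) (h : Cartan) : dot (-B h) (perp u) = -baryAcross u h.1 := by
  simp [dot, B, perp, CartanReal.bary, baryAcross]
  ring

theorem rpow_third_pow {z : ℝ} (hz : 0 ≤ z) : (z ^ (1 / 3 : ℝ)) ^ 3 = z := by
  rw [← Real.rpow_natCast, ← Real.rpow_mul hz]
  norm_num

theorem rpow_third_le {z w : ℝ} (hz : 0 ≤ z) (hw : 0 ≤ w) (h : z ≤ w ^ 3) :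
    z ^ (1 / 3 : ℝ) ≤ w := by
  refine le_of_pow_le_pow_left₀ three_ne_zero hw ?_
  rwa [rpow_third_pow hz]

theorem max_rpow_third_le {x z : ℝ} (hz : 0 ≤ z) (hx : x ≤ 3 * z + 3) :
    max x 0 ^ (1 / 3 : ℝ) ≤ 3 * z ^ (1 / 3 : ℝ) + 3 := by
  have hr : 0 ≤ z ^ (1 / 3 : ℝ) := Real.rpow_nonneg hz _
  have h3 := rpow_third_pow hz
  refine rpow_third_le (le_max_right _ _) (by positivity) (max_le ?_ (by positivity))
  generalize z ^ (1 / 3 : ℝ) = r at *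
  have : 0 ≤ r ^ 3 := by positivity
  nlinarith [sq_nonneg r]

/-- The constant `1/15` comes from `2904 < 15³`. -/
theorem rpow_third_le_busemann {u : ℝ × ℝ} (hu : u.1 ^ 2 + u.2 ^ 2 = 1) (h2 : 0 ≤ u.2)
    (h3 : u.2 ≤ u.1) (τ : Bool) {h : Cartan} (hh : h.1.IsLoop) (hp : 0 ≤ -baryAcross u h.1) :
    1 / 15 * (-baryAcross u h.1) ^ (1 / 3 : ℝ) ≤ busemann (rayPath u τ) h := by
  refine le_busemann (h2.trans h3) h2 τ fun n => ?_
  have key := baryAcross_inv_le hu h2 h3 τ hh n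
  have h3' := rpow_third_pow hp
  have hr : 0 ≤ (-baryAcross u h.1) ^ (1 / 3 : ℝ) := Real.rpow_nonneg hp _
  by_contra hcon
  have hlt : (norm (h⁻¹ * rayPath u τ n) : ℝ) - n < 1 / 15 * (-baryAcross u h.1) ^ (1 / 3 : ℝ) := by
    linarith
  have := (Odd.strictMono_pow (R := ℝ) (by decide : Odd 3)) hlt
  simp only [mul_pow, h3'] at this
  linarith

/-- For `u = t(a, b)` the values of `baryAcross u` lie in `(t/6)ℤ`, so the positive ones are bounded
away from `0`. -/
theorem exists_third_bound_of_odd {u : ℝ × ℝ}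
    (hodd : ∃ a b : ℤ, Odd a ∧ Odd b ∧ HasDirection u a b) : ∃ p₀ : ℝ, 0 < p₀ ∧
      ∀ h : Cartan, 0 < -baryAcross u h.1 → p₀ ≤ -baryAcross u h.1 := by
  obtain ⟨a, b, -, -, t, ht, rfl⟩ := hodd
  refine ⟨t / 6, by positivity, fun h hp => ?_⟩
  obtain ⟨-, -, -, m, n, -, -, -, hm, hn⟩ := exists_int_coords h
  have e : -baryAcross (t * a, t * b) h.1 = t / 6 * ((m * b - n * a : ℤ) : ℝ) := by
    simp only [baryAcross]
    push_cast
    rw [← hm, ← hn]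
    ring
  rw [e] at hp ⊢
  have h1 : (0 : ℝ) < ((m * b - n * a : ℤ) : ℝ) := pos_of_mul_pos_right hp (by positivity)
  have h2 : 0 < m * b - n * a := by exact_mod_cast h1
  have h3 : (1 : ℝ) ≤ ((m * b - n * a : ℤ) : ℝ) := by exact_mod_cast h2
  have : 0 < t / 6 := by positivity
  nlinarith

theorem estimates_of_le {u : ℝ × ℝ} (hu : u.1 ^ 2 + u.2 ^ 2 = 1) (h2 : 0 ≤ u.2) (h3 : u.2 ≤ u.1)
    (τ : Bool) : Estimates u τ := by
  have h1 : 0 ≤ u.1 := h2.trans h3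
  refine ⟨tendsto_busemann h1 h2 τ, ?_⟩
  obtain ⟨K₁, hK₁, b₁⟩ := exists_busemann_le hu h2 h3 τ (exists_move_area hu h2 h3 τ 0)
  -- The constants must be fixed before the conditions on `u` are assumed, hence a default value
  -- when flat moves do not exist.
  obtain ⟨K₂, hK₂, b₂⟩ : ∃ K₂ : ℝ, 0 < K₂ ∧
      ((∀ c : ℝ, ∃ j f, Move u τ 0 0 j f ∧ |f.1.area - c| ≤ 1 ∧ |baryAcross u f.1| ≤ 1) →
        ∀ h : Cartan, h.1.IsLoop → busemann (rayPath u τ) h ≤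
          60 * (max (-baryAcross u h.1 + 1) 0) ^ (1 / 3 : ℝ) + K₂) := by
    by_cases hf : ∀ c : ℝ, ∃ j f, Move u τ 0 0 j f ∧ |f.1.area - c| ≤ 1 ∧ |baryAcross u f.1| ≤ 1
    · obtain ⟨K, hK, b⟩ := exists_busemann_le hu h2 h3 τ (G := fun _ => 1) hf
      exact ⟨K, hK, fun _ => b⟩
    · exact ⟨1, one_pos, fun h => absurd h hf⟩
  have b₂' : (∀ c : ℝ, ∃ j f, Move u τ 0 0 j f ∧ |f.1.area - c| ≤ 1 ∧ |baryAcross u f.1| ≤ 1) →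
      ∀ h : Cartan, h.1.IsLoop → 0 < -baryAcross u h.1 → busemann (rayPath u τ) h ≤
        180 * (-baryAcross u h.1) ^ (1 / 3 : ℝ) + (180 + K₂) := by
    intro hf h hh hp
    have := max_rpow_third_le hp.le (by linarith : -baryAcross u h.1 + 1 ≤ 3 * -baryAcross u h.1 + 3)
    linarith [b₂ hf h hh]
  obtain ⟨K₃, hK₃, b₃⟩ : ∃ K₃ : ℝ, 0 < K₃ ∧
      ((∃ a b : ℤ, Odd a ∧ Odd b ∧ HasDirection u a b) →
        ∀ h : Cartan, h.1.IsLoop → 0 < -baryAcross u h.1 →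
          busemann (rayPath u τ) h ≤ K₃ * (-baryAcross u h.1) ^ (1 / 3 : ℝ)) := by
    by_cases hodd : ∃ a b : ℤ, Odd a ∧ Odd b ∧ HasDirection u a b
    · obtain ⟨p₀, hp₀, hp⟩ := exists_third_bound_of_odd hodd
      have hr₀ : 0 < p₀ ^ (1 / 3 : ℝ) := Real.rpow_pos_of_pos hp₀ _
      refine ⟨180 + (180 + K₂) / p₀ ^ (1 / 3 : ℝ), by positivity, fun _ h hh hpos => ?_⟩
      obtain ⟨a, b, ha, hb, hd⟩ := hodd
      have h0 : 0 < u.1 := by nlinarith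
      have h2' : 0 < u.2 := by
        refine h2.lt_of_ne' fun h => ?_
        obtain ⟨t, ht, rfl⟩ := hd
        simp only [mul_eq_zero, ht.ne', false_or] at h
        have : b = 0 := by exact_mod_cast h
        rw [this] at hb
        exact absurd hb (by decide)
      have e := b₂' (exists_flat_move_of_odd h0 h2' τ ha hb hd) h hh hpos
      have hle : p₀ ^ (1 / 3 : ℝ) ≤ (-baryAcross u h.1) ^ (1 / 3 : ℝ) :=
        Real.rpow_le_rpow hp₀.le (hp h hpos) (by norm_num)
      have : (180 + K₂) ≤ (180 + K₂) / p₀ ^ (1 / 3 : ℝ) * (-baryAcross u h.1) ^ (1 / 3 : ℝ) := by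
        rw [div_mul_eq_mul_div, le_div_iff₀ hr₀]
        gcongr
      linarith
    · exact ⟨1, one_pos, fun h => absurd h hodd⟩
  refine ⟨1 / 15, 180 + (180 + K₁) + (180 + K₂) + K₃, by norm_num, by positivity, ?_, ?_, ?_⟩
  · intro h hh
    rw [dot_neg_B]
    have hb := b₁ h hh
    rw [abs_neg] at hb
    have hA : 0 ≤ |A h| := abs_nonneg _
    refine ⟨fun hp => ⟨rpow_third_le_busemann hu h2 h3 τ hh hp, ?_⟩,
      fun hp => ⟨busemann_nonneg h1 h2 τ hh, ?_⟩⟩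
    · have hr : 0 ≤ (-baryAcross u h.1 + |A h|) ^ (1 / 3 : ℝ) := by positivity
      have := max_rpow_third_le (by linarith : 0 ≤ -baryAcross u h.1 + |A h|)
        (by linarith :
          -baryAcross u h.1 + 3 * (|A h| + 1) ≤ 3 * (-baryAcross u h.1 + |A h|) + 3)
      simp only [A] at this hr ⊢
      nlinarith
    · have hr : 0 ≤ |A h| ^ (1 / 3 : ℝ) := by positivity
      have := max_rpow_third_le hA
        (by linarith : -baryAcross u h.1 + 3 * (|A h| + 1) ≤ 3 * |A h| + 3)
      simp only [A] at this hr ⊢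
      nlinarith
  · intro hdir h hh
    have hf := exists_flat_move_of_direction hu h2 h3 τ hdir
    rw [dot_neg_B]
    refine ⟨fun hp => ⟨rpow_third_le_busemann hu h2 h3 τ hh hp.le, ?_⟩, fun hp => ?_⟩
    · have hr : 0 ≤ (-baryAcross u h.1) ^ (1 / 3 : ℝ) := by positivity
      have := b₂' hf h hh hp
      nlinarith
    · rw [abs_of_nonneg (busemann_nonneg h1 h2 τ hh)]
      have := max_rpow_third_le le_rfl (by linarith : -baryAcross u h.1 + 1 ≤ 3 * 0 + 3)
      rw [Real.zero_rpow (by norm_num)] at this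
      linarith [b₂ hf h hh]
  · intro hodd h hh hp
    rw [dot_neg_B] at hp ⊢
    have hr : 0 ≤ (-baryAcross u h.1) ^ (1 / 3 : ℝ) := by positivity
    have := b₃ hodd h hh hp
    nlinarith

/-! ### Symmetries -/

theorem Estimates.transfer {u u' : ℝ × ℝ} {τ τ' : Bool} (e : Cartan → Cartan) (he : e 1 = 1)
    (hdist : ∀ n g, dist (rayPath u' τ' n) (e g) = dist (rayPath u τ n) g)
    (hloop : ∀ g : Cartan, g.1.IsLoop → (e g).1.IsLoop) (hA : ∀ g, |A (e g)| = |A g|)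
    (hB : ∀ g, dot (-B (e g)) (perp u') = dot (-B g) (perp u))
    (hxor : (∃ a b : ℤ, Xor (Even a) (Even b) ∧ HasDirection u' a b) →
      ∃ a b : ℤ, Xor (Even a) (Even b) ∧ HasDirection u a b)
    (hodd : (∃ a b : ℤ, Odd a ∧ Odd b ∧ HasDirection u a b) →
      ∃ a b : ℤ, Odd a ∧ Odd b ∧ HasDirection u' a b)
    (h : Estimates u' τ') : Estimates u τ := by
  have hd1 : ∀ n, dist (rayPath u' τ' n) 1 = dist (rayPath u τ n) 1 := fun n => by
    rw [← hdist n 1, he]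
  have hb : ∀ g, busemann (rayPath u' τ') (e g) = busemann (rayPath u τ) g := fun g => by
    simp only [busemann, hdist, hd1]
  obtain ⟨hlim, C₁, C₂, h1, h2, k1, k2, k3⟩ := h
  refine ⟨fun g => ?_, C₁, C₂, h1, h2, fun g hg => ?_, fun hn g hg => ?_, fun ho g hg => ?_⟩
  · simpa only [hdist, hd1, hb] using hlim (e g)
  · simpa only [hB, hb, hA] using k1 (e g) (hloop g hg)
  · simpa only [hB, hb] using k2 (fun h => hn (hxor h)) (e g) (hloop g hg)
  · simpa only [hB, hb] using k3 (hodd ho) (e g) (hloop g hg)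

/-- The restriction to the Cartan group of an endomorphism preserving the generators. -/
noncomputable def restrictHom (φ : CartanReal →* CartanReal)
    (hX : φ CartanReal.genX ∈ Subgroup.closure {CartanReal.genX, CartanReal.genY})
    (hY : φ CartanReal.genY ∈ Subgroup.closure {CartanReal.genX, CartanReal.genY}) :
    Cartan →* Cartan :=
  (φ.comp (Subgroup.subtype _)).codRestrict _ fun g => by
    have : Subgroup.closure {CartanReal.genX, CartanReal.genY} ≤
        (Subgroup.closure {CartanReal.genX, CartanReal.genY}).comap φ := by
      rw [Subgroup.closure_le]
      rintro x (rfl | rfl)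
      exacts [hX, hY]
    exact this g.2

theorem norm_map_le (e : Cartan →* Cartan) (he : ∀ s ∈ S, e s ∈ S) (g : Cartan) :
    norm (e g) ≤ norm g := by
  obtain ⟨l, h1, h2, rfl⟩ := exists_list_length_eq_norm g
  rw [← h1, map_list_prod]
  simpa using norm_prod_le (l.map e) (by
    intro s hs
    obtain ⟨t, ht, rfl⟩ := List.mem_map.1 hs
    exact he t (h2 t ht))

theorem dist_map (e : Cartan →* Cartan) (he : ∀ s ∈ S, e s ∈ S) (hinv : ∀ g, e (e g) = g)
    (g h : Cartan) : dist (e g) (e h) = dist g h := by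
  rw [dist, dist, ← map_inv, ← map_mul]
  refine le_antisymm (norm_map_le e he _) ?_
  conv_lhs => rw [← hinv (g⁻¹ * h)]
  exact norm_map_le e he _

/-- The automorphism of `C_ℝ` exchanging the two axes. -/
noncomputable def swapReal : CartanReal →* CartanReal :=
  MonoidHom.mk' (fun g => ⟨g.y, g.x, -g.area, -g.baryY, -g.baryX⟩) fun g h => by
    ext <;> simp only [CartanReal.mul_x, CartanReal.mul_y, CartanReal.mul_area,
      CartanReal.mul_baryX, CartanReal.mul_baryY, CartanReal.det] <;> ring

/-- The automorphism of `C_ℝ` reversing the first axis. -/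
noncomputable def reflectReal : CartanReal →* CartanReal :=
  MonoidHom.mk' (fun g => ⟨-g.x, g.y, -g.area, g.baryX, -g.baryY⟩) fun g h => by
    ext <;> simp only [CartanReal.mul_x, CartanReal.mul_y, CartanReal.mul_area,
      CartanReal.mul_baryX, CartanReal.mul_baryY, CartanReal.det] <;> ring

theorem swapReal_genX : swapReal CartanReal.genX = CartanReal.genY := by
  ext <;> simp [swapReal, CartanReal.genX, CartanReal.genY]

theorem swapReal_genY : swapReal CartanReal.genY = CartanReal.genX := by
  ext <;> simp [swapReal, CartanReal.genX, CartanReal.genY]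

theorem reflectReal_genX : reflectReal CartanReal.genX = CartanReal.genX⁻¹ := by
  ext <;> simp [reflectReal, CartanReal.genX]

theorem reflectReal_genY : reflectReal CartanReal.genY = CartanReal.genY := by
  ext <;> simp [reflectReal, CartanReal.genY]

/-- The automorphism of `C` exchanging the two generators. -/
noncomputable def swapHom : Cartan →* Cartan :=
  restrictHom swapReal (by rw [swapReal_genX]; exact Y.2) (by rw [swapReal_genY]; exact X.2)

/-- The automorphism of `C` inverting the first generator. -/
noncomputable def reflectHom : Cartan →* Cartan :=
  restrictHom reflectReal (by rw [reflectReal_genX]; exact X⁻¹.2)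
    (by rw [reflectReal_genY]; exact Y.2)

theorem swapHom_X : swapHom X = Y := Subtype.ext swapReal_genX

theorem swapHom_Y : swapHom Y = X := Subtype.ext swapReal_genY

theorem reflectHom_X : reflectHom X = X⁻¹ := Subtype.ext reflectReal_genX

theorem reflectHom_Y : reflectHom Y = Y := Subtype.ext reflectReal_genY

theorem dist_swapHom (g h : Cartan) : dist (swapHom g) (swapHom h) = dist g h := by
  refine dist_map _ ?_ ?_ g h
  · rintro s (rfl | rfl | rfl | rfl) <;> simp [swapHom_X, swapHom_Y, S]
  · intro g
    apply Subtype.ext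
    ext <;> simp [swapHom, restrictHom, swapReal]

theorem dist_reflectHom (g h : Cartan) : dist (reflectHom g) (reflectHom h) = dist g h := by
  refine dist_map _ ?_ ?_ g h
  · rintro s (rfl | rfl | rfl | rfl) <;> simp [reflectHom_X, reflectHom_Y, S]
  · intro g
    apply Subtype.ext
    ext <;> simp [reflectHom, restrictHom, reflectReal]

theorem rayHat_succ_eq_or (u : ℝ × ℝ) (τ : Bool) (n : ℕ) :
    (rayHat u τ (n + 1)).1 = (rayHat u τ n).1 ∨ (rayHat u τ (n + 1)).2 = (rayHat u τ n).2 := by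
  simp only [rayHat, rayState]
  split_ifs <;> simp

/-- Exchanging the axes exchanges horizontal and vertical, so the Boolean is negated. -/
theorem rayState_swap (u : ℝ × ℝ) (τ : Bool) (n : ℕ) :
    rayState (u.2, u.1) (!τ) n = ((rayState u τ n).1.swap, !(rayState u τ n).2) := by
  induction n with
  | zero => rfl
  | succ n ih =>
    have hs : ∀ p : ℤ × ℤ, side (u.2, u.1) p.swap = -side u p := by
      intro p
      simp only [side, dot, perp, nextCenter, Prod.fst_swap, Prod.snd_swap]
      ring
    simp only [rayState, ih, hs, Left.neg_pos_iff, Left.neg_neg_iff, Prod.fst_swap, Prod.snd_swap]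
    rcases lt_trichotomy (side u (rayState u τ n).1) 0 with h | h | h
    · simp [h, h.not_gt]
    · cases ht : (rayState u τ n).2 <;> simp [h]
    · simp [h, h.not_gt]

/-- The strict inequality matters: `orient 0 = 1`, so the rule is not symmetric at `u.1 = 0`. -/
theorem rayState_reflect {u : ℝ × ℝ} (hu : u.1 < 0) (τ : Bool) (n : ℕ) :
    rayState (-u.1, u.2) τ n = ((-(rayState u τ n).1.1, (rayState u τ n).1.2),
      (rayState u τ n).2) := by
  have o1 : orient u.1 = -1 := by simp [orient, hu]
  have o2 : orient (-u.1) = 1 := by simp [orient, hu.le]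
  induction n with
  | zero => simp [rayState]
  | succ n ih =>
    have hs : ∀ p : ℤ × ℤ, side (-u.1, u.2) (-p.1, p.2) = side u p := by
      intro p
      simp only [side, dot, perp, nextCenter, o1, o2]
      push_cast
      ring
    simp only [rayState, ih, hs, o1, o2]
    rcases lt_trichotomy (side u (rayState u τ n).1) 0 with h | h | h
    · simp [h, h.not_gt]
    · cases ht : (rayState u τ n).2 <;> simp [h]
      ring
    · simp [h]
      ring

theorem swapHom_rayPath (u : ℝ × ℝ) (τ : Bool) (n : ℕ) :
    swapHom (rayPath u τ n) = rayPath (u.2, u.1) (!τ) n := by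
  induction n with
  | zero => simp [rayPath]
  | succ n ih =>
    simp only [rayPath, map_mul, map_zpow, swapHom_X, swapHom_Y, ih]
    have h : ∀ m, rayHat (u.2, u.1) (!τ) m = (rayHat u τ m).swap := fun m => by
      rw [rayHat, rayState_swap]; rfl
    rw [h, h]
    rcases rayHat_succ_eq_or u τ n with h' | h' <;> simp [h']

theorem reflectHom_rayPath {u : ℝ × ℝ} (hu : u.1 < 0) (τ : Bool) (n : ℕ) :
    reflectHom (rayPath u τ n) = rayPath (-u.1, u.2) τ n := by
  induction n with
  | zero => simp [rayPath]
  | succ n ih =>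
    simp only [rayPath, map_mul, map_zpow, reflectHom_X, reflectHom_Y, ih]
    have h : ∀ m, rayHat (-u.1, u.2) τ m = (-(rayHat u τ m).1, (rayHat u τ m).2) := fun m => by
      rw [rayHat, rayState_reflect hu]; rfl
    rw [h, h]
    simp only [inv_zpow', neg_sub, neg_sub_neg]

theorem HasDirection.swap {u : ℝ × ℝ} {a b : ℤ} (h : HasDirection u a b) :
    HasDirection (u.2, u.1) b a := by
  obtain ⟨t, ht, rfl⟩ := h
  exact ⟨t, ht, rfl⟩

theorem HasDirection.reflect {u : ℝ × ℝ} {a b : ℤ} (h : HasDirection u a b) :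
    HasDirection (-u.1, u.2) (-a) b := by
  obtain ⟨t, ht, rfl⟩ := h
  exact ⟨t, ht, by simp⟩

/-- The exchange reverses orientation, so winding numbers change sign; it also sends `u^⊥` to the
opposite of the rotated image of `u`, and the two signs cancel in `⟨-B; u^⊥⟩`. -/
theorem Estimates.of_swap {u : ℝ × ℝ} {τ : Bool} (h : Estimates (u.2, u.1) (!τ)) :
    Estimates u τ := by
  refine h.transfer swapHom (map_one _) (fun n g => ?_) ?_ ?_ ?_ ?_ ?_
  · rw [← swapHom_rayPath, dist_swapHom]
  · exact fun g hg => ⟨hg.2, hg.1⟩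
  · exact fun g => abs_neg _
  · intro g
    change dot (-(-g.1.baryY, -g.1.baryX)) _ = _
    simp [dot, perp, B, CartanReal.bary]
    ring
  · rintro ⟨a, b, hx, hd⟩
    exact ⟨b, a, (xor_comm _ _).mp hx, hd.swap⟩
  · rintro ⟨a, b, ha, hb, hd⟩
    exact ⟨b, a, hb, ha, hd.swap⟩

theorem Estimates.of_reflect {u : ℝ × ℝ} {τ : Bool} (hu : u.1 < 0)
    (h : Estimates (-u.1, u.2) τ) : Estimates u τ := by
  refine h.transfer reflectHom (map_one _) (fun n g => ?_) ?_ ?_ ?_ ?_ ?_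
  · rw [← reflectHom_rayPath hu, dist_reflectHom]
  · exact fun g hg => ⟨neg_eq_zero.2 hg.1, hg.2⟩
  · exact fun g => abs_neg _
  · intro g
    change dot (-(g.1.baryX, -g.1.baryY)) _ = _
    simp [dot, perp, B, CartanReal.bary]
  · rintro ⟨a, b, hx, hd⟩
    exact ⟨-a, b, by simpa using hx, by simpa using hd.reflect⟩
  · rintro ⟨a, b, ha, hb, hd⟩
    exact ⟨-a, b, ha.neg, hb, hd.reflect⟩

theorem estimates {u : ℝ × ℝ} (hu : u.1 ^ 2 + u.2 ^ 2 = 1) (τ : Bool) : Estimates u τ := by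
  have pos : ∀ (u : ℝ × ℝ) (τ : Bool), u.1 ^ 2 + u.2 ^ 2 = 1 → 0 ≤ u.1 → 0 ≤ u.2 →
      Estimates u τ := by
    intro u τ hu h1 h2
    rcases le_total u.2 u.1 with h | h
    · exact estimates_of_le hu h2 h τ
    · exact (estimates_of_le (u := (u.2, u.1)) (by simp only; linarith) h1 h (!τ)).of_swap
  have half : ∀ (u : ℝ × ℝ) (τ : Bool), u.1 ^ 2 + u.2 ^ 2 = 1 → 0 ≤ u.2 → Estimates u τ := by
    intro u τ hu h2
    rcases le_or_gt 0 u.1 with h | h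
    · exact pos u τ hu h h2
    · exact (pos (-u.1, u.2) τ (by simpa using hu) (by simp only; linarith) h2).of_reflect h
  rcases le_or_gt 0 u.2 with h | h
  · exact half u τ hu h
  -- Reflection in the other axis is the reflection conjugated by the exchange of the axes.
  · refine Estimates.of_swap (Estimates.of_reflect h ?_)
    refine Estimates.of_swap ?_
    exact half (u.1, -u.2) _ (by simpa using hu) (by simp only; linarith)

theorem isLoop_of_mem_commutator {h : Cartan} (hh : h ∈ commutator Cartan) : h.1.IsLoop := by
  let f : Cartan →* Multiplicative (ℝ × ℝ) :=
    MonoidHom.mk' (fun g => Multiplicative.ofAdd (g.1.x, g.1.y)) fun g h => by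
      rw [← ofAdd_add]; simp
  have := Abelianization.commutator_subset_ker f hh
  rw [MonoidHom.mem_ker] at this
  have h2 : (h.1.x, h.1.y) = ((0, 0) : ℝ × ℝ) := this
  exact ⟨congrArg Prod.fst h2, congrArg Prod.snd h2⟩

end Cartan

theorem mainTheorem2 (u : ℝ × ℝ) (hu : u.1 ^ 2 + u.2 ^ 2 = 1) (τ : Bool) :
    (∀ g : Cartan,
      Tendsto
        (fun n : ℕ => (Cartan.dist (Cartan.rayPath u τ n) g : ℝ) -
          (Cartan.dist (Cartan.rayPath u τ n) 1 : ℝ))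
        atTop (𝓝 (Cartan.busemann (Cartan.rayPath u τ) g))) ∧
    ∃ C₁ C₂ : ℝ, 0 < C₁ ∧ 0 < C₂ ∧
      (∀ h ∈ commutator Cartan,
        (0 ≤ Cartan.dot (-Cartan.B h) (Cartan.perp u) →
          C₁ * Cartan.dot (-Cartan.B h) (Cartan.perp u) ^ (1 / 3 : ℝ) ≤
              Cartan.busemann (Cartan.rayPath u τ) h ∧
          Cartan.busemann (Cartan.rayPath u τ) h ≤
            C₂ * (Cartan.dot (-Cartan.B h) (Cartan.perp u) + |Cartan.A h|) ^ (1 / 3 : ℝ) + C₂) ∧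
        (Cartan.dot (-Cartan.B h) (Cartan.perp u) ≤ 0 →
          0 ≤ Cartan.busemann (Cartan.rayPath u τ) h ∧
          Cartan.busemann (Cartan.rayPath u τ) h ≤ C₂ * |Cartan.A h| ^ (1 / 3 : ℝ) + C₂)) ∧
      ((¬ ∃ a b : ℤ, Xor (Even a) (Even b) ∧ Cartan.HasDirection u a b) →
        ∀ h ∈ commutator Cartan,
          (0 < Cartan.dot (-Cartan.B h) (Cartan.perp u) →
            C₁ * Cartan.dot (-Cartan.B h) (Cartan.perp u) ^ (1 / 3 : ℝ) ≤
                Cartan.busemann (Cartan.rayPath u τ) h ∧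
            Cartan.busemann (Cartan.rayPath u τ) h ≤
              C₂ * Cartan.dot (-Cartan.B h) (Cartan.perp u) ^ (1 / 3 : ℝ) + C₂) ∧
          (Cartan.dot (-Cartan.B h) (Cartan.perp u) ≤ 0 →
            |Cartan.busemann (Cartan.rayPath u τ) h| ≤ C₂)) ∧
      ((∃ a b : ℤ, Odd a ∧ Odd b ∧ Cartan.HasDirection u a b) →
        ∀ h ∈ commutator Cartan,
          0 < Cartan.dot (-Cartan.B h) (Cartan.perp u) →
            Cartan.busemann (Cartan.rayPath u τ) h ≤
              C₂ * Cartan.dot (-Cartan.B h) (Cartan.perp u) ^ (1 / 3 : ℝ)) := by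
  obtain ⟨hlim, C₁, C₂, h1, h2, k1, k2, k3⟩ := Cartan.estimates hu τ
  exact ⟨hlim, C₁, C₂, h1, h2, fun h hh => k1 h (Cartan.isLoop_of_mem_commutator hh),
    fun hd h hh => k2 hd h (Cartan.isLoop_of_mem_commutator hh),
    fun hd h hh => k3 hd h (Cartan.isLoop_of_mem_commutator hh)⟩
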